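/- Let $0<\varepsilon<2$ and $\ell[h]=\varepsilon\,(\sin(\theta)\,h')'+h'$ on $(-\pi,\pi)$. All function spaces are complex. Let $L$ be the operator $Lh=\ell[h]$ in $L^2(-\pi,\pi)$ whose domain consists of all $h$ in the Sobolev space $W^1_2(-\pi,\pi)$ with $h(-\pi)=h(\pi)$ and $\sin(\theta)\,h'\in W^1_2(-\pi,\pi)$. Let $L_{\min}$ be the closure in $L^2(-\pi,\pi)$ of the operator $h\mapsto\ell[h]$ defined on the finite trigonometric polynomials $h(\theta)=\sum_{|n|\le N}v_ne^{in\theta}$, $v_n\in\mathbb C$. Identify the Hardy space $H^2(\mathbb D)$ of the unit disc with a subspace of $L^2(-\pi,\pi)$ through the radial boundary values $u(e^{i\theta})=\lim_{r\to1-0}u(re^{i\theta})$, and let $H^{2,0}(\mathbb D)$ be the subspace of those elements of $H^2(\mathbb D)$ that are orthogonal to the constant function $1$. Let $L_+$ be the part of $L_{\min}$ in $H^{2,0}(\mathbb D)$, that is, the operator in $H^{2,0}(\mathbb D)$ with graph $\{(u,L_{\min}u): u\in \mathrm{Dom}(L_{\min})\cap H^{2,0}(\mathbb D),\ L_{\min}u\in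 H^{2,0}(\mathbb D)\}$, and let $A_+=-iL_+$. Then every eigenvalue of $A_+$ is real and positive, and every eigenvalue of $L$ is purely imaginary, i.e. has real part $0$ (the eigenvalue $0$ of $L$, with the constants as eigenfunctions, is included). -/

import Mathlib

open MeasureTheory Set Filter Topology
open scoped ContDiff

noncomputable section

namespace ForwardBackwardHeat

/-! ### The Hilbert space `L²(-π, π)` -/

/-- Lebesgue measure on the interval `(-π, π)`. -/
abbrev arc : Measure ℝ := volume.restrict (Ioo (-Real.pi) Real.pi)

/-- The complex Hilbert space `L²(-π, π)`. -/
abbrev L2 : Type := Lp ℂ 2 arc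

/-! ### Eigenvalues and parts of unbounded operators -/

/-- `z` is an eigenvalue of the (unbounded) operator `T`. -/
def IsEigenvalue {E : Type*} [AddCommGroup E] [Module ℂ E] (T : E →ₗ.[ℂ] E) (z : ℂ) : Prop :=
  ∃ u : T.domain, (u : E) ≠ 0 ∧ T u = z • (u : E)

/-- The graph of the part of `T` in `K`: all `(x, y) ∈ K × K` with `x ∈ Dom T`, `T x = y`. -/
def partGraph {E : Type*} [AddCommGroup E] [Module ℂ E] (T : E →ₗ.[ℂ] E) (K : Submodule ℂ E) :
    Submodule ℂ (K × K) :=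
  T.graph.comap (K.subtype.prodMap K.subtype)

/-- The part of the operator `T` in the subspace `K`, as an operator in `K`. -/
def part {E : Type*} [AddCommGroup E] [Module ℂ E] (T : E →ₗ.[ℂ] E) (K : Submodule ℂ E) :
    K →ₗ.[ℂ] K :=
  (partGraph T K).toLinearPMap

theorem part_graph {E : Type*} [AddCommGroup E] [Module ℂ E] (T : E →ₗ.[ℂ] E)
    (K : Submodule ℂ E) : (part T K).graph = partGraph T K := by
  refine Submodule.toLinearPMap_graph_eq _ ?_
  rintro ⟨x, y⟩ hxy hx
  have h : ((x : E), (y : E)) ∈ T.graph := hxy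
  have hx' : (x : E) = 0 := by simpa using congrArg Subtype.val hx
  exact Subtype.ext (T.graph_fst_eq_zero_snd h hx')

/-! ### The operator `L` on its maximal periodic domain -/

/-- `g` is the weak derivative of `h` on `(-π, π)` (`h`, `g` locally integrable there). -/
def IsWeakDeriv (h g : ℝ → ℂ) : Prop :=
  ∀ φ : ℝ → ℝ, ContDiff ℝ ∞ φ → HasCompactSupport φ →
    tsupport φ ⊆ Ioo (-Real.pi) Real.pi →
    ∫ θ, deriv φ θ • h θ ∂arc = - ∫ θ, φ θ • g θ ∂arc

/-- `h` has a representative that is continuous on `[-π, π]` and equal at the two endpoints. -/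
def IsPeriodic (h : ℝ → ℂ) : Prop :=
  ∃ H : ℝ → ℂ, ContinuousOn H (Icc (-Real.pi) Real.pi) ∧ H (-Real.pi) = H Real.pi ∧ h =ᵐ[arc] H

theorem integrable_smul {φ : ℝ → ℝ} (hφ : Continuous φ) (hc : HasCompactSupport φ) (h : L2) :
    Integrable (fun θ => φ θ • h θ) arc := by
  have hi : Integrable (fun θ => h θ) arc := (Lp.memLp h).integrable (by norm_num)
  obtain ⟨C, hC⟩ := hc.exists_bound_of_continuous hφ
  exact hi.bdd_smul C hφ.aestronglyMeasurable (Eventually.of_forall hC)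

theorem IsWeakDeriv.congr {h h' g g' : ℝ → ℂ} (H : IsWeakDeriv h g) (hh : h' =ᵐ[arc] h)
    (hg : g' =ᵐ[arc] g) : IsWeakDeriv h' g' := by
  intro φ h1 h2 h3
  have e1 : ∫ θ, deriv φ θ • h' θ ∂arc = ∫ θ, deriv φ θ • h θ ∂arc :=
    integral_congr_ae (hh.mono fun θ e => by simp only [e])
  have e2 : ∫ θ, φ θ • g' θ ∂arc = ∫ θ, φ θ • g θ ∂arc :=
    integral_congr_ae (hg.mono fun θ e => by simp only [e])
  rw [e1, e2]
  exact H φ h1 h2 h3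

theorem sin_mul_memLp (g : L2) : MemLp (fun θ => (Real.sin θ : ℂ) * g θ) 2 arc := by
  refine (Lp.memLp g).of_le_mul (c := 1) ?_ (Eventually.of_forall fun θ => ?_)
  · exact (by fun_prop : Continuous fun θ : ℝ => (Real.sin θ : ℂ)).aestronglyMeasurable.mul
      (Lp.aestronglyMeasurable g)
  · rw [norm_mul, Complex.norm_real]
    exact mul_le_mul_of_nonneg_right (Real.abs_sin_le_one θ) (norm_nonneg _)

/-- The product `sin(θ) g(θ)` as an element of `L²(-π, π)`. -/
def sinMul (g : L2) : L2 := (sin_mul_memLp g).toLp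

theorem sinMul_ae (g : L2) : sinMul g =ᵐ[arc] fun θ => (Real.sin θ : ℂ) * g θ :=
  MemLp.coeFn_toLp _

theorem sinMul_add (g g' : L2) : sinMul (g + g') = sinMul g + sinMul g' := by
  apply Lp.ext
  filter_upwards [sinMul_ae g, sinMul_ae g', sinMul_ae (g + g'), Lp.coeFn_add g g',
    Lp.coeFn_add (sinMul g) (sinMul g')] with θ h1 h2 h3 h4 h5
  rw [h3, h4, h5, Pi.add_apply, Pi.add_apply, h1, h2, mul_add]

theorem sinMul_smul (c : ℂ) (g : L2) : sinMul (c • g) = c • sinMul g := by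
  apply Lp.ext
  filter_upwards [sinMul_ae g, sinMul_ae (c • g), Lp.coeFn_smul c g,
    Lp.coeFn_smul c (sinMul g)] with θ h1 h3 h4 h5
  rw [h3, h4, h5, Pi.smul_apply, Pi.smul_apply, h1, smul_eq_mul, smul_eq_mul, mul_left_comm]

theorem IsWeakDeriv.add {h g h' g' : L2} (H : IsWeakDeriv h g) (H' : IsWeakDeriv h' g') :
    IsWeakDeriv (h + h' : L2) (g + g' : L2) := by
  refine IsWeakDeriv.congr ?_ (Lp.coeFn_add h h') (Lp.coeFn_add g g')
  intro φ h1 h2 h3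
  have hd : Continuous (deriv φ) := h1.continuous_deriv (by simp)
  simp only [Pi.add_apply, smul_add]
  rw [integral_add (integrable_smul hd h2.deriv h) (integrable_smul hd h2.deriv h'),
    integral_add (integrable_smul h1.continuous h2 g) (integrable_smul h1.continuous h2 g'),
    H φ h1 h2 h3, H' φ h1 h2 h3]
  ring

theorem IsWeakDeriv.smul {h g : L2} (c : ℂ) (H : IsWeakDeriv h g) :
    IsWeakDeriv (c • h : L2) (c • g : L2) := by
  refine IsWeakDeriv.congr ?_ (Lp.coeFn_smul c h) (Lp.coeFn_smul c g)
  intro φ h1 h2 h3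
  simp only [Pi.smul_apply, smul_comm _ c]
  rw [integral_smul, integral_smul, H φ h1 h2 h3, smul_neg]

theorem isWeakDeriv_zero : IsWeakDeriv (0 : L2) (0 : L2) := by
  refine IsWeakDeriv.congr (h := 0) (g := 0) ?_ (Lp.coeFn_zero _ _ _) (Lp.coeFn_zero _ _ _)
  intro φ _ _ _
  simp

/-- The graph of `L`: all pairs `(h, f)` such that `h` lies in the periodic Sobolev space
`W¹₂` with weak derivative `g = h'`, the function `sin(θ) g` lies in `W¹₂` with weak
derivative `k = (sin(θ) h')'`, and `f = ε (sin(θ) h')' + h'`. -/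
def LGraph (ε : ℝ) : Submodule ℂ (L2 × L2) where
  carrier := {x | IsPeriodic x.1 ∧ ∃ g k : L2, IsWeakDeriv x.1 g ∧ IsWeakDeriv (sinMul g) k ∧
    x.2 = (ε : ℂ) • k + g}
  zero_mem' := by
    refine ⟨⟨0, continuousOn_const, rfl, Lp.coeFn_zero _ _ _⟩, 0, 0, isWeakDeriv_zero, ?_, ?_⟩
    · have : sinMul 0 = 0 := by simpa using sinMul_smul 0 0
      rw [this]
      exact isWeakDeriv_zero
    · simp
  add_mem' := by
    rintro ⟨h, f⟩ ⟨h', f'⟩ ⟨⟨H, hc, hp, he⟩, g, k, h1, h2, h3⟩ ⟨⟨H', hc', hp', he'⟩, g', k', h1', h2', h3'⟩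
    refine ⟨⟨H + H', hc.add hc', by simp [hp, hp'], ?_⟩, g + g', k + k', h1.add h1', ?_, ?_⟩
    · exact (Lp.coeFn_add h h').trans (he.add he')
    · rw [sinMul_add]
      exact h2.add h2'
    · simp only [Prod.snd_add] at h3 h3' ⊢
      rw [h3, h3', smul_add]
      abel
  smul_mem' := by
    rintro c ⟨h, f⟩ ⟨⟨H, hc, hp, he⟩, g, k, h1, h2, h3⟩
    refine ⟨⟨c • H, hc.const_smul c, by simp [hp], ?_⟩, c • g, c • k, h1.smul c, ?_, ?_⟩
    · exact (Lp.coeFn_smul c h).trans (he.const_smul c)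
    · rw [sinMul_smul]
      exact h2.smul c
    · simp only [Prod.smul_snd] at h3 ⊢
      rw [h3, smul_add, smul_comm]

/-- The operator `L h = ε (sin(θ) h')' + h'` in `L²(-π, π)` whose domain consists of the
`h` in the periodic Sobolev space `W¹₂` with `sin(θ) h'` in `W¹₂`. -/
def L (ε : ℝ) : L2 →ₗ.[ℂ] L2 := (LGraph ε).toLinearPMap

/-- An element of `L²(-π, π)` that integrates to zero against all test functions vanishes. -/
theorem eq_zero_of_test {f : L2} (H : ∀ φ : ℝ → ℝ, ContDiff ℝ ∞ φ → HasCompactSupport φ →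
    tsupport φ ⊆ Ioo (-Real.pi) Real.pi → ∫ θ, φ θ • f θ ∂arc = 0) : f = 0 := by
  have hi : IntegrableOn (fun θ => f θ) (Ioo (-Real.pi) Real.pi) :=
    (Lp.memLp f).integrable (by norm_num)
  have h0 := isOpen_Ioo.ae_eq_zero_of_integral_contDiff_smul_eq_zero
    (μ := volume) hi.locallyIntegrableOn (by
      intro φ h1 h2 h3
      rw [← H φ h1 h2 h3]
      refine (setIntegral_eq_integral_of_forall_compl_eq_zero fun x hx => ?_).symm
      rw [image_eq_zero_of_notMem_tsupport (fun h => hx (h3 h)), zero_smul])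
  apply Lp.ext
  refine EventuallyEq.trans ?_ (Lp.coeFn_zero _ _ _).symm
  exact (ae_restrict_iff' measurableSet_Ioo).2 h0

/-- The formal adjoint `ε (sin(θ) φ')' - φ'` of the differential expression. -/
def ellAdj (ε : ℝ) (φ : ℝ → ℝ) (θ : ℝ) : ℝ :=
  ε * deriv (fun t => Real.sin t * deriv φ t) θ - deriv φ θ

/-- The pairs `(h, f)` for which `ε (sin(θ) h')' + h' = f` in the sense of distributions. -/
def IsDistSol (ε : ℝ) (h f : L2) : Prop :=
  ∀ φ : ℝ → ℝ, ContDiff ℝ ∞ φ → HasCompactSupport φ → tsupport φ ⊆ Ioo (-Real.pi) Real.pi →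
    ∫ θ, φ θ • f θ ∂arc = ∫ θ, ellAdj ε φ θ • h θ ∂arc

theorem isDistSol_of_weakDeriv {ε : ℝ} {h g k : L2} (h1 : IsWeakDeriv h g)
    (h2 : IsWeakDeriv (sinMul g) k) : IsDistSol ε h ((ε : ℂ) • k + g) := by
  intro φ p1 p2 p3
  have hd : ContDiff ℝ ∞ (deriv φ) := ((contDiff_infty_iff_deriv).1 p1).2
  have hs : ContDiff ℝ ∞ (fun t => Real.sin t * deriv φ t) := Real.contDiff_sin.mul hd
  have hsc : HasCompactSupport (fun t => Real.sin t * deriv φ t) := p2.deriv.mul_left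
  have hst : tsupport (fun t => Real.sin t * deriv φ t) ⊆ Ioo (-Real.pi) Real.pi :=
    ((tsupport_mul_subset_right (f := Real.sin) (g := deriv φ)).trans
      (tsupport_deriv_subset (𝕜 := ℝ) (f := φ))).trans p3
  have hdd : Continuous (deriv fun t => Real.sin t * deriv φ t) := hs.continuous_deriv (by simp)
  have e1 := h1 φ p1 p2 p3
  have e2 := h2 φ p1 p2 p3
  have e3 := h1 _ hs hsc hst
  have e4 : ∫ θ, deriv φ θ • sinMul g θ ∂arc = ∫ θ, (Real.sin θ * deriv φ θ) • g θ ∂arc := by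
    refine integral_congr_ae ((sinMul_ae g).mono fun θ hθ => ?_)
    simp only [hθ, Complex.real_smul]
    push_cast
    ring
  have e5 : ∫ θ, φ θ • ((ε : ℂ) • k + g : L2) θ ∂arc
      = ∫ θ, ((ε : ℂ) • (φ θ • k θ) + φ θ • g θ) ∂arc := by
    refine integral_congr_ae ?_
    filter_upwards [Lp.coeFn_add ((ε : ℂ) • k) g, Lp.coeFn_smul (ε : ℂ) k] with θ a b
    rw [a, Pi.add_apply, b, Pi.smul_apply, smul_add, smul_comm]
  have e6 : ∫ θ, ellAdj ε φ θ • h θ ∂arc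
      = ∫ θ, ((ε : ℂ) • (deriv (fun t => Real.sin t * deriv φ t) θ • h θ)
        - deriv φ θ • h θ) ∂arc := by
    refine integral_congr_ae (Eventually.of_forall fun θ => ?_)
    simp only [ellAdj, Complex.real_smul, smul_eq_mul]
    push_cast
    ring
  have e7 : ∫ θ, ((ε : ℂ) • (φ θ • k θ) + φ θ • g θ) ∂arc
      = (∫ θ, (ε : ℂ) • (φ θ • k θ) ∂arc) + ∫ θ, φ θ • g θ ∂arc :=
    integral_add ((integrable_smul p1.continuous p2 k).smul (ε : ℂ))
      (integrable_smul p1.continuous p2 g)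
  have e8 : ∫ θ, ((ε : ℂ) • (deriv (fun t => Real.sin t * deriv φ t) θ • h θ)
        - deriv φ θ • h θ) ∂arc
      = (∫ θ, (ε : ℂ) • (deriv (fun t => Real.sin t * deriv φ t) θ • h θ) ∂arc)
        - ∫ θ, deriv φ θ • h θ ∂arc :=
    integral_sub ((integrable_smul hdd hsc.deriv h).smul (ε : ℂ))
      (integrable_smul hd.continuous p2.deriv h)
  rw [e5, e6, e7, e8, integral_smul, integral_smul, e3, ← e4, e2, e1]
  simp

theorem IsDistSol.eq_zero {ε : ℝ} {f : L2} (H : IsDistSol ε 0 f) : f = 0 := by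
  refine eq_zero_of_test fun φ p1 p2 p3 => ?_
  rw [H φ p1 p2 p3]
  refine integral_eq_zero_of_ae ((Lp.coeFn_zero ℂ 2 arc).mono fun θ hθ => ?_)
  simp only [hθ, Pi.zero_apply, smul_zero]

theorem isDistSol_of_mem {ε : ℝ} {x : L2 × L2} (hx : x ∈ LGraph ε) : IsDistSol ε x.1 x.2 := by
  obtain ⟨_, g, k, h1, h2, h3⟩ := hx
  rw [h3]
  exact isDistSol_of_weakDeriv h1 h2

/-- The graph of `L` is the one that was prescribed. -/
theorem L_graph (ε : ℝ) : (L ε).graph = LGraph ε := by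
  refine Submodule.toLinearPMap_graph_eq _ ?_
  rintro ⟨h, f⟩ hx (rfl : h = 0)
  exact (isDistSol_of_mem hx).eq_zero

/-! ### The minimal operator -/

/-- The exponential `θ ↦ e^{inθ}`. -/
def expMode (n : ℤ) (θ : ℝ) : ℂ := Complex.exp (n * θ * Complex.I)

/-- The finite trigonometric polynomials. -/
def PFin : Submodule ℂ (ℝ → ℂ) := Submodule.span ℂ (range expMode)

/-- The differential expression `ℓ[h] = ε (sin(θ) h')' + h'` with classical derivatives. -/
def ell (ε : ℝ) (h : ℝ → ℂ) (θ : ℝ) : ℂ :=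
  ε * deriv (fun t : ℝ => (Real.sin t : ℂ) * deriv h t) θ + deriv h θ

theorem contDiff_of_mem {p : ℝ → ℂ} (hp : p ∈ PFin) : ContDiff ℝ ∞ p := by
  refine Submodule.span_induction (p := fun p _ => ContDiff ℝ ∞ p) ?_ contDiff_const
    (fun _ _ _ _ h1 h2 => h1.add h2) (fun c _ _ h => h.const_smul c) hp
  rintro _ ⟨n, rfl⟩
  have : ContDiff ℝ ∞ (fun θ : ℝ => (θ : ℂ)) := Complex.ofRealCLM.contDiff
  exact ((contDiff_const.mul this).mul contDiff_const).cexp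

theorem contDiff_sin_mul {p : ℝ → ℂ} (hp : ContDiff ℝ ∞ p) :
    ContDiff ℝ ∞ (fun t : ℝ => (Real.sin t : ℂ) * deriv p t) :=
  (Complex.ofRealCLM.contDiff.comp Real.contDiff_sin).mul ((contDiff_infty_iff_deriv).1 hp).2

theorem ell_add (ε : ℝ) {p q : ℝ → ℂ} (hp : ContDiff ℝ ∞ p) (hq : ContDiff ℝ ∞ q) :
    ell ε (p + q) = ell ε p + ell ε q := by
  have e : deriv (p + q) = deriv p + deriv q := by
    ext θ
    exact deriv_add (hp.differentiable (by simp) θ) (hq.differentiable (by simp) θ)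
  ext θ
  have e2 : (fun t : ℝ => (Real.sin t : ℂ) * deriv (p + q) t)
      = (fun t : ℝ => (Real.sin t : ℂ) * deriv p t) + fun t : ℝ => (Real.sin t : ℂ) * deriv q t := by
    ext t
    simp only [e, Pi.add_apply, mul_add]
  simp only [ell, Pi.add_apply]
  rw [e2, deriv_add ((contDiff_sin_mul hp).differentiable (by simp) θ)
    ((contDiff_sin_mul hq).differentiable (by simp) θ), e, Pi.add_apply]
  ring

theorem ell_smul (ε : ℝ) (c : ℂ) {p : ℝ → ℂ} (hp : ContDiff ℝ ∞ p) :
    ell ε (c • p) = c • ell ε p := by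
  have e : deriv (c • p) = c • deriv p := by
    ext θ
    exact deriv_const_smul c (hp.differentiable (by simp) θ)
  ext θ
  have e2 : (fun t : ℝ => (Real.sin t : ℂ) * deriv (c • p) t)
      = c • (fun t : ℝ => (Real.sin t : ℂ) * deriv p t) := by
    ext t
    simp only [e, Pi.smul_apply, smul_eq_mul]
    ring
  simp only [ell, Pi.smul_apply]
  rw [e2, deriv_const_smul c ((contDiff_sin_mul hp).differentiable (by simp) θ), e, Pi.smul_apply]
  simp only [smul_eq_mul]
  ring

/-- The graph of `L_fin`: all pairs (`h`, `ℓ[h]`), with `h` a trigonometric polynomial. -/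
def LFinGraph (ε : ℝ) : Submodule ℂ (L2 × L2) where
  carrier := {x | ∃ p ∈ PFin, x.1 =ᵐ[arc] p ∧ x.2 =ᵐ[arc] ell ε p}
  zero_mem' := by
    refine ⟨0, zero_mem _, Lp.coeFn_zero _ _ _, (Lp.coeFn_zero _ _ _).trans ?_⟩
    have : ell ε 0 = 0 := by simpa using ell_smul ε 0 (p := 0) contDiff_const
    rw [this]
  add_mem' := by
    rintro ⟨h, f⟩ ⟨h', f'⟩ ⟨p, hp, h1, h2⟩ ⟨p', hp', h1', h2'⟩
    refine ⟨p + p', add_mem hp hp', (Lp.coeFn_add h h').trans (h1.add h1'), ?_⟩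
    rw [ell_add ε (contDiff_of_mem hp) (contDiff_of_mem hp')]
    exact (Lp.coeFn_add f f').trans (h2.add h2')
  smul_mem' := by
    rintro c ⟨h, f⟩ ⟨p, hp, h1, h2⟩
    refine ⟨c • p, PFin.smul_mem c hp, (Lp.coeFn_smul c h).trans (h1.const_smul c), ?_⟩
    rw [ell_smul ε c (contDiff_of_mem hp)]
    exact (Lp.coeFn_smul c f).trans (h2.const_smul c)

theorem expMode_period (n : ℤ) : expMode n (-Real.pi) = expMode n Real.pi := by
  unfold expMode
  rw [Complex.exp_eq_exp_iff_exists_int]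
  exact ⟨-n, by push_cast; ring⟩

theorem isPeriodic_of_mem {p : ℝ → ℂ} (hp : p ∈ PFin) : p (-Real.pi) = p Real.pi := by
  refine Submodule.span_induction (p := fun p _ => p (-Real.pi) = p Real.pi) ?_ rfl
    (fun _ _ _ _ h1 h2 => by simp [h1, h2]) (fun c _ _ h => by simp [h]) hp
  rintro _ ⟨n, rfl⟩
  exact expMode_period n

theorem memLp_of_continuous {p : ℝ → ℂ} (hp : Continuous p) : MemLp p 2 arc := by
  obtain ⟨C, hC⟩ := (isCompact_Icc (a := -Real.pi) (b := Real.pi)).exists_bound_of_continuousOn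
    hp.continuousOn
  exact MemLp.of_bound hp.aestronglyMeasurable C ((ae_restrict_mem measurableSet_Ioo).mono
    fun θ hθ => hC θ (Ioo_subset_Icc_self hθ))

theorem integral_arc_eq {F : ℝ → ℂ} (hF : tsupport F ⊆ Ioo (-Real.pi) Real.pi) :
    ∫ θ, F θ ∂arc = ∫ θ, F θ :=
  setIntegral_eq_integral_of_forall_compl_eq_zero fun _ hx =>
    image_eq_zero_of_notMem_tsupport fun h => hx (hF h)

theorem isWeakDeriv_of_contDiff {p : ℝ → ℂ} (hp : ContDiff ℝ ∞ p) : IsWeakDeriv p (deriv p) := by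
  intro φ p1 p2 p3
  have hd : Continuous (deriv φ) := p1.continuous_deriv (by simp)
  have hpd : Continuous (deriv p) := hp.continuous_deriv (by simp)
  have h1 : HasCompactSupport (fun θ => deriv φ θ • p θ) := p2.deriv.smul_right
  have h2 : HasCompactSupport (fun θ => φ θ • deriv p θ) := p2.smul_right
  have h3 : HasCompactSupport (fun θ => φ θ • p θ) := p2.smul_right
  have i1 : Integrable (fun θ => deriv φ θ • p θ) :=
    (hd.smul hp.continuous).integrable_of_hasCompactSupport (μ := volume) h1
  have i2 : Integrable (fun θ => φ θ • deriv p θ) :=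
    (p1.continuous.smul hpd).integrable_of_hasCompactSupport (μ := volume) h2
  have i3 := (p1.continuous.smul hp.continuous).integrable_of_hasCompactSupport (μ := volume) h3
  rw [integral_arc_eq, integral_arc_eq, ← add_eq_zero_iff_eq_neg, ← integral_add i1 i2]
  · refine integral_eq_zero_of_hasDerivAt_of_integrable (f := fun θ => φ θ • p θ)
      (fun θ => ?_) (i1.add i2) i3
    have := ((p1.differentiable (by simp) θ).hasDerivAt).smul
      ((hp.differentiable (by simp) θ).hasDerivAt)
    rw [add_comm]
    exact this
  · exact (tsupport_smul_subset_left φ (deriv p)).trans p3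
  · exact ((tsupport_smul_subset_left (deriv φ) p).trans
      (tsupport_deriv_subset (𝕜 := ℝ) (f := φ))).trans p3

theorem LFinGraph_le (ε : ℝ) : LFinGraph ε ≤ LGraph ε := by
  rintro ⟨h, f⟩ ⟨p, hp, h1, h2⟩
  have hs := contDiff_of_mem hp
  have hs' := contDiff_sin_mul hs
  have m1 := memLp_of_continuous (hs.continuous_deriv (by simp))
  have m2 := memLp_of_continuous (hs'.continuous_deriv (by simp))
  refine ⟨⟨p, hs.continuous.continuousOn, isPeriodic_of_mem hp, h1⟩, m1.toLp, m2.toLp, ?_, ?_, ?_⟩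
  · exact (isWeakDeriv_of_contDiff hs).congr h1 m1.coeFn_toLp
  · refine (isWeakDeriv_of_contDiff hs').congr ?_ m2.coeFn_toLp
    filter_upwards [sinMul_ae m1.toLp, m1.coeFn_toLp] with θ a b
    rw [a, b]
  · apply Lp.ext
    filter_upwards [h2, m1.coeFn_toLp, m2.coeFn_toLp, Lp.coeFn_add ((ε : ℂ) • m2.toLp) m1.toLp,
      Lp.coeFn_smul (ε : ℂ) m2.toLp] with θ a b c d e
    rw [a, d, Pi.add_apply, e, Pi.smul_apply, b, c]
    rfl

/-- The operator `L_fin h = ℓ[h]` on the finite trigonometric polynomials. -/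
def LFin (ε : ℝ) : L2 →ₗ.[ℂ] L2 := (LFinGraph ε).toLinearPMap

theorem LFin_graph (ε : ℝ) : (LFin ε).graph = LFinGraph ε := by
  refine Submodule.toLinearPMap_graph_eq _ ?_
  rintro ⟨h, f⟩ hx (rfl : h = 0)
  exact (isDistSol_of_mem (LFinGraph_le ε hx)).eq_zero

theorem continuous_integral_smul {φ : ℝ → ℝ} (hφ : Continuous φ) :
    Continuous fun f : L2 => ∫ θ, φ θ • f θ ∂arc := by
  have m := memLp_of_continuous (Complex.continuous_ofReal.comp hφ)
  have e : (fun f : L2 => ∫ θ, φ θ • f θ ∂arc) = fun f : L2 => inner ℂ m.toLp f := by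
    ext f
    rw [L2.inner_def]
    refine integral_congr_ae (m.coeFn_toLp.mono fun θ hθ => ?_)
    simp [hθ, mul_comm]
  rw [e]
  fun_prop

theorem LFin_isClosable (ε : ℝ) : (LFin ε).IsClosable := by
  have key : ∀ x ∈ (LFin ε).graph.topologicalClosure, IsDistSol ε x.1 x.2 := by
    intro x hx φ p1 p2 p3
    have hd : ContDiff ℝ ∞ (deriv φ) := ((contDiff_infty_iff_deriv).1 p1).2
    have hs : ContDiff ℝ ∞ (fun t => Real.sin t * deriv φ t) := Real.contDiff_sin.mul hd
    have hc : Continuous (ellAdj ε φ) :=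
      (continuous_const.mul (hs.continuous_deriv (by simp))).sub hd.continuous
    have hcl : IsClosed {y : L2 × L2 |
        ∫ θ, φ θ • y.2 θ ∂arc = ∫ θ, ellAdj ε φ θ • y.1 θ ∂arc} :=
      isClosed_eq ((continuous_integral_smul p1.continuous).comp continuous_snd)
        ((continuous_integral_smul hc).comp continuous_fst)
    refine closure_minimal (fun y hy => ?_) hcl hx
    rw [LFin_graph] at hy
    exact isDistSol_of_mem (LFinGraph_le ε hy) φ p1 p2 p3
  refine ⟨(LFin ε).graph.topologicalClosure.toLinearPMap, (Submodule.toLinearPMap_graph_eq _ ?_).symm⟩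
  rintro ⟨h, f⟩ hx (rfl : h = 0)
  exact (key _ hx).eq_zero

/-- The minimal operator: the closure of `L_fin` in `L²(-π, π)`. -/
def LMin (ε : ℝ) : L2 →ₗ.[ℂ] L2 := (LFin ε).closure

/-- The graph of the minimal operator is the closure of the graph of `L_fin`. -/
theorem LMin_graph (ε : ℝ) : (LMin ε).graph = (LFinGraph ε).topologicalClosure := by
  rw [← LFin_graph]
  exact (LFin_isClosable ε).graph_closure_eq_closure_graph.symm

/-! ### Hardy spaces and the operators `L₊` and `A₊` -/

/-- `U` belongs to the Hardy space `H²` of the open unit disc. -/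
def IsHardy (U : ℂ → ℂ) : Prop :=
  DifferentiableOn ℂ U (Metric.ball 0 1) ∧
    ∃ C : ℝ, ∀ r ∈ Ico (0 : ℝ) 1, ∫ θ, ‖U (r * Complex.exp (θ * Complex.I))‖ ^ 2 ∂arc ≤ C

theorem IsHardy.integrable {U : ℂ → ℂ} (hU : DifferentiableOn ℂ U (Metric.ball 0 1)) {r : ℝ}
    (hr : r ∈ Ico (0 : ℝ) 1) :
    Integrable (fun θ : ℝ => ‖U (r * Complex.exp (θ * Complex.I))‖ ^ 2) arc := by
  have hc : Continuous (fun θ : ℝ => U (r * Complex.exp (θ * Complex.I))) := by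
    refine hU.continuousOn.comp_continuous (by fun_prop) fun θ => ?_
    simpa [Complex.norm_exp_ofReal_mul_I, abs_of_nonneg hr.1] using hr.2
  exact ((hc.norm.pow 2).integrableOn_Icc (a := -Real.pi) (b := Real.pi)).mono_set Ioo_subset_Icc_self

theorem IsHardy.add {U V : ℂ → ℂ} (hU : IsHardy U) (hV : IsHardy V) : IsHardy (U + V) := by
  obtain ⟨hU, C, hC⟩ := hU
  obtain ⟨hV, D, hD⟩ := hV
  refine ⟨hU.add hV, 2 * C + 2 * D, fun r hr => ?_⟩
  refine le_trans (integral_mono (IsHardy.integrable (hU.add hV) hr)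
    (((IsHardy.integrable hU hr).const_mul 2).add ((IsHardy.integrable hV hr).const_mul 2))
    fun θ => ?_) (le_trans (le_of_eq (integral_add
      ((IsHardy.integrable hU hr).const_mul 2) ((IsHardy.integrable hV hr).const_mul 2))) ?_)
  · simp only [Pi.add_apply]
    have h := norm_add_le (U (r * Complex.exp (θ * Complex.I))) (V (r * Complex.exp (θ * Complex.I)))
    nlinarith [norm_nonneg (U (r * Complex.exp (θ * Complex.I)) + V (r * Complex.exp (θ * Complex.I))),
      sq_nonneg (‖U (r * Complex.exp (θ * Complex.I))‖ - ‖V (r * Complex.exp (θ * Complex.I))‖)]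
  · rw [integral_const_mul, integral_const_mul]
    linarith [hC r hr, hD r hr]

theorem IsHardy.smul {U : ℂ → ℂ} (c : ℂ) (hU : IsHardy U) : IsHardy (c • U) := by
  obtain ⟨hU, C, hC⟩ := hU
  refine ⟨hU.const_smul c, ‖c‖ ^ 2 * C, fun r hr => ?_⟩
  simp only [Pi.smul_apply, norm_smul, mul_pow]
  rw [integral_const_mul]
  exact mul_le_mul_of_nonneg_left (hC r hr) (by positivity)

/-- The Hardy space `H²` of the disc as a subspace of `L²(-π, π)`: the functions `h` that are
the radial boundary values `h(θ) = lim_{r → 1-} U(r e^{iθ})` of some `U` in `H²`. -/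
def Hardy : Submodule ℂ L2 where
  carrier := {h | ∃ U : ℂ → ℂ, IsHardy U ∧ ∀ᵐ θ : ℝ ∂arc,
    Tendsto (fun r : ℝ => U (r * Complex.exp (θ * Complex.I))) (𝓝[<] 1) (𝓝 (h θ))}
  zero_mem' := by
    refine ⟨0, ⟨differentiableOn_const 0, 0, fun r _ => by simp⟩, ?_⟩
    filter_upwards [Lp.coeFn_zero ℂ 2 arc] with θ hθ
    rw [hθ]
    exact tendsto_const_nhds
  add_mem' := by
    rintro h h' ⟨U, hU, hl⟩ ⟨U', hU', hl'⟩
    refine ⟨U + U', hU.add hU', ?_⟩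
    filter_upwards [hl, hl', Lp.coeFn_add h h'] with θ a b e
    rw [e]
    exact a.add b
  smul_mem' := by
    rintro c h ⟨U, hU, hl⟩
    refine ⟨c • U, hU.smul c, ?_⟩
    filter_upwards [hl, Lp.coeFn_smul c h] with θ a e
    rw [e]
    exact a.const_smul c

/-- The subspace of `H²` orthogonal to the constant function `1`. -/
def Hardy0 : Submodule ℂ L2 := Hardy ⊓ (Submodule.span ℂ {Lp.const 2 arc (1 : ℂ)})ᗮ

/-- The operator `L₊` in `Hardy0`: the part of the minimal operator in that subspace. -/
def LPlus (ε : ℝ) : Hardy0 →ₗ.[ℂ] Hardy0 := part (LMin ε) Hardy0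

/-- The operator `A₊ = -i L₊`. -/
def APlus (ε : ℝ) : Hardy0 →ₗ.[ℂ] Hardy0 := (-Complex.I) • LPlus ε

end ForwardBackwardHeat

end

noncomputable section

namespace ForwardBackwardHeat

/-! ### The singular Sturm–Liouville problem on `(0, 1)` -/

/-! In Fourier coefficients the operator is tridiagonal: with spectral parameter `i μ`, an
eigenfunction satisfies μ vₙ = n vₙ + (ε/2)(n(n-1) vₙ₋₁ - n(n+1) vₙ₊₁) (`coef_of_mem_LGraph`,
`coef_of_mem_LMin_graph`). The factors n(n-1) and n(n+1) cut the links out of mode 0, so positive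
and negative modes form separate systems, exchanged by n ↦ -n, μ ↦ -μ.

For the positive modes the generating function u(x) = Σ vₙ xⁿ solves ((1-x²)u')' = (2/ε)(u' - μu/x)
on (0,1). The weight w = ((1-x)/(1+x))^(1/ε) puts this in the Sturm–Liouville form (w(1-x²)u')' =
-(2μ/ε) w u/x. Pairing with the conjugate of u gives ∫ w(1-x²)|u'|² = μ ∫ (2/ε) w|u|²/x, hence μ >
0, provided the boundary terms vanish (`re_pos_of_ode`). At 0 this follows from v₀ = 0. At 1, square
summability gives u = O((1-x)^(-1/2)), and ε < 2 turns this into wu → 0, which excludes the singular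
solution (`momentum_bound`).

An element of `Hardy0` has no modes n ≤ 0, so a nonzero one has a positive mode and the eigenvalue
of `APlus` is such a μ. An eigenfunction of `L` has a positive mode, a negative mode, or only the
constant mode; in each case μ = -iz is real. -/

theorem deriv_eq_zero_of_tendsto_zero {f f' : ℝ → ℝ} {a b : ℝ}
    (hf : ∀ x ∈ Ioo a b, HasDerivAt f (f' x) x) (hf' : ∀ x ∈ Ioo a b, 0 ≤ f' x)
    (ha : Tendsto f (𝓝[>] a) (𝓝 0)) (hb : Tendsto f (𝓝[<] b) (𝓝 0)) :
    ∀ x ∈ Ioo a b, f' x = 0 := by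
  have hm : MonotoneOn f (Ioo a b) := by
    refine monotoneOn_of_deriv_nonneg (convex_Ioo a b)
      (fun x hx => (hf x hx).continuousAt.continuousWithinAt) (fun x hx => ?_) (fun x hx => ?_)
    · rw [interior_Ioo] at hx
      exact (hf x hx).differentiableAt.differentiableWithinAt
    · rw [interior_Ioo] at hx
      rw [(hf x hx).deriv]
      exact hf' x hx
  -- A monotone function with limit zero at both ends is squeezed to zero. This replaces integrating
  -- `f'` and needs no integrability.
  have hz : ∀ x ∈ Ioo a b, f x = 0 := by
    intro x hx
    refine le_antisymm (ge_of_tendsto hb ?_) (le_of_tendsto ha ?_)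
    · filter_upwards [Ioo_mem_nhdsLT hx.2] with y hy
      exact hm hx ⟨hx.1.trans hy.1, hy.2⟩ hy.1.le
    · filter_upwards [Ioo_mem_nhdsGT hx.1] with y hy
      exact hm ⟨hy.1, hy.2.trans hx.2⟩ hx hy.2.le
  intro x hx
  have h0 : HasDerivAt f 0 x := (hasDerivAt_const x (0 : ℝ)).congr_of_eventuallyEq
    (by filter_upwards [Ioo_mem_nhds hx.1 hx.2] with y hy using hz y hy)
  exact (hf x hx).unique h0

/-- The integrating factor `((1 - x) / (1 + x)) ^ (1 / ε)`. -/
def weight (ε x : ℝ) : ℝ := ((1 - x) / (1 + x)) ^ (1 / ε)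

theorem weight_pos {ε x : ℝ} (hx : x ∈ Ioo (0 : ℝ) 1) : 0 < weight ε x :=
  Real.rpow_pos_of_pos (div_pos (by linarith [hx.2]) (by linarith [hx.1])) _

theorem weight_le {ε x : ℝ} (hε : 0 < ε) (hx : x ∈ Ioo (0 : ℝ) 1) :
    weight ε x ≤ (1 - x) ^ (1 / ε) := by
  obtain ⟨h0, h1⟩ := hx
  refine Real.rpow_le_rpow (div_nonneg (by linarith) (by linarith)) ?_ (by positivity)
  exact div_le_self (by linarith) (by linarith)

/-- The logarithmic derivative -(2/ε)/(1-x²) is what cancels the first-order term (2/ε)u' of the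
equation. -/
theorem hasDerivAt_weight {ε x : ℝ} (hx : x ∈ Ioo (0 : ℝ) 1) :
    HasDerivAt (weight ε) (-(2 / ε) / (1 - x ^ 2) * weight ε x) x := by
  obtain ⟨h0, h1⟩ := hx
  have ha : 0 < 1 - x := by linarith
  have hb : 0 < 1 + x := by linarith
  have hq : 0 < (1 - x) / (1 + x) := div_pos ha hb
  have h := (((hasDerivAt_id x).const_sub 1).div ((hasDerivAt_id x).const_add 1) hb.ne').rpow_const
    (p := 1 / ε) (Or.inl hq.ne')
  refine h.congr_deriv ?_
  have e : ((1 - x) / (1 + x)) ^ (1 / ε - 1)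
      = ((1 - x) / (1 + x)) ^ (1 / ε) / ((1 - x) / (1 + x)) := Real.rpow_sub_one hq.ne' _
  have e2 : 1 - x ^ 2 = (1 - x) * (1 + x) := by ring
  simp only [id, Pi.div_apply] at *
  rw [e, weight, e2]
  generalize ((1 - x) / (1 + x)) ^ (1 / ε) = M
  field_simp
  ring

theorem tendsto_one_sub_rpow {s : ℝ} (hs : 0 < s) :
    Tendsto (fun x : ℝ => (1 - x) ^ s) (𝓝[<] 1) (𝓝 0) := by
  have h : ContinuousAt (fun x : ℝ => (1 - x) ^ s) 1 :=
    (continuousAt_const.sub continuousAt_id).rpow_const (Or.inr hs.le)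
  have h' := h.tendsto
  simp only [sub_self, Real.zero_rpow hs.ne'] at h'
  exact h'.mono_left nhdsWithin_le_nhds

/-- The condition ε < 2 enters through this exponent: it makes 1/ε - 1/2 positive, so that the
weighted solution tends to 0 at 1. -/
theorem norm_weight_mul_le {ε B : ℝ} (hε : 0 < ε) {u : ℝ → ℂ}
    (hB : ∀ x ∈ Ioo (0 : ℝ) 1, ‖u x‖ ≤ B * (1 - x) ^ (-(1 / 2) : ℝ)) {x : ℝ}
    (hx : x ∈ Ioo (0 : ℝ) 1) : weight ε x * ‖u x‖ ≤ B * (1 - x) ^ (1 / ε - 1 / 2) := by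
  have ha : 0 < 1 - x := by linarith [hx.2]
  calc weight ε x * ‖u x‖ ≤ (1 - x) ^ (1 / ε) * (B * (1 - x) ^ (-(1 / 2) : ℝ)) :=
        mul_le_mul (weight_le hε hx) (hB x hx) (norm_nonneg _) (Real.rpow_nonneg ha.le _)
    _ = B * (1 - x) ^ (1 / ε - 1 / 2) := by
        rw [sub_eq_add_neg (1 / ε), Real.rpow_add ha]
        ring

/-- The momentum `weight * (1 - x²) u'` of a solution of moderate growth vanishes linearly at the
singular endpoint: otherwise `u` would grow like the inverse of the weight. -/
theorem momentum_bound {ε B K : ℝ} (hε0 : 0 < ε) (hε2 : ε < 2) {u u' f f' : ℝ → ℂ}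
    (hu : ∀ x ∈ Ioo (0 : ℝ) 1, HasDerivAt u (u' x) x)
    (hf : ∀ x ∈ Ioo (0 : ℝ) 1, HasDerivAt f (f' x) x)
    (hfu : ∀ x ∈ Ioo (0 : ℝ) 1, f x = weight ε x * ((1 - x ^ 2) * u' x))
    (hB : ∀ x ∈ Ioo (0 : ℝ) 1, ‖u x‖ ≤ B * (1 - x) ^ (-(1 / 2) : ℝ))
    (hK : ∀ x ∈ Ico (1 / 2 : ℝ) 1, ‖f' x‖ ≤ K) :
    ∀ x ∈ Ico (1 / 2 : ℝ) 1, ‖f x‖ ≤ K * (1 - x) := by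
  intro x₀ hx₀
  by_contra! hcon
  set c := f x₀ with hc
  have hK0 : 0 ≤ K := (norm_nonneg _).trans (hK x₀ hx₀)
  have hcpos : 0 < ‖c‖ := lt_of_le_of_lt (mul_nonneg hK0 (by linarith [hx₀.2])) hcon
  -- On [x₀, 1) the function f moves by at most K(1-x₀) from c, so δ bounds Re(c̄ f) from below
  -- there.
  set δ := ‖c‖ * (‖c‖ - K * (1 - x₀)) with hδ
  have hδpos : 0 < δ := mul_pos hcpos (by linarith)
  have hmem : ∀ x ∈ Ico x₀ 1, x ∈ Ioo (0 : ℝ) 1 := fun x hx => ⟨by linarith [hx.1, hx₀.1], hx.2⟩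
  have hlow : ∀ x ∈ Ico x₀ 1, δ ≤ ((starRingEnd ℂ) c * f x).re := by
    intro x hx
    have h1 : ‖f x - f x₀‖ ≤ K * ‖x - x₀‖ := by
      refine (convex_Ico x₀ 1).norm_image_sub_le_of_norm_hasDerivWithin_le
        (fun y hy => (hf y (hmem y hy)).hasDerivWithinAt)
        (fun y hy => hK y ⟨hx₀.1.trans hy.1, hy.2⟩) ⟨le_rfl, hx₀.2⟩ hx
    have h2 : ‖f x - f x₀‖ ≤ K * (1 - x₀) := by
      refine h1.trans (mul_le_mul_of_nonneg_left ?_ hK0)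
      rw [Real.norm_eq_abs, abs_of_nonneg (by linarith [hx.1])]
      linarith [hx.2]
    have h3 : (starRingEnd ℂ) c * f x = (‖c‖ ^ 2 : ℝ) + (starRingEnd ℂ) c * (f x - f x₀) := by
      rw [mul_sub, ← hc, mul_comm _ c, Complex.mul_conj, Complex.normSq_eq_norm_sq]
      ring
    have h4 : |((starRingEnd ℂ) c * (f x - f x₀)).re| ≤ ‖c‖ * (K * (1 - x₀)) := by
      refine (Complex.abs_re_le_norm _).trans ?_
      rw [norm_mul, RCLike.norm_conj]
      exact mul_le_mul_of_nonneg_left h2 (norm_nonneg _)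
    rw [h3, Complex.add_re, Complex.ofReal_re]
    nlinarith [neg_abs_le ((starRingEnd ℂ) c * (f x - f x₀)).re]
  -- Since (1/w)' = (2/ε)/((1-x²)w), the constant δε/2 makes g' = (Re(c̄ f) - δ)/(w(1-x²)), which is
  -- nonnegative.
  let g : ℝ → ℝ := fun x => ((starRingEnd ℂ) c * u x).re - δ * ε / 2 * (weight ε x)⁻¹
  have hg : ∀ x ∈ Ico x₀ 1, HasDerivAt g (((starRingEnd ℂ) c * u' x).re
      - δ * ε / 2 * (-(-(2 / ε) / (1 - x ^ 2) * weight ε x) / weight ε x ^ 2)) x := by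
    intro x hx
    refine HasDerivAt.sub ?_ (((hasDerivAt_weight (hmem x hx)).inv
      (weight_pos (hmem x hx)).ne').const_mul _)
    exact Complex.reCLM.hasFDerivAt.comp_hasDerivAt x ((hu x (hmem x hx)).const_mul _)
  have hgm : MonotoneOn g (Ico x₀ 1) := by
    refine monotoneOn_of_deriv_nonneg (convex_Ico x₀ 1)
      (fun x hx => (hg x hx).continuousAt.continuousWithinAt) (fun x hx => ?_) (fun x hx => ?_)
    · exact (hg x (interior_subset hx)).differentiableAt.differentiableWithinAt
    · replace hx := interior_subset hx
      have hm := hmem x hx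
      rw [(hg x hx).deriv, sub_nonneg]
      have hw := weight_pos (ε := ε) hm
      have hs : 0 < 1 - x ^ 2 := by nlinarith [hm.1, hm.2]
      have e1 : ((starRingEnd ℂ) c * f x).re
          = weight ε x * (1 - x ^ 2) * ((starRingEnd ℂ) c * u' x).re := by
        rw [hfu x hm, ← Complex.re_ofReal_mul]
        congr 1
        push_cast
        ring
      have h := hlow x hx
      rw [e1] at h
      have e2 : δ * ε / 2 * (-(-(2 / ε) / (1 - x ^ 2) * weight ε x) / weight ε x ^ 2)
          = δ / (weight ε x * (1 - x ^ 2)) := by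
        field_simp
      rw [e2, div_le_iff₀ (by positivity), mul_comm (Complex.re _)]
      exact h
  have hs : 0 < 1 / ε - 1 / 2 := by
    rw [sub_pos]
    exact one_div_lt_one_div_of_lt hε0 hε2
  have t1 : Tendsto (fun x => ‖c‖ * (B * (1 - x) ^ (1 / ε - 1 / 2)) - δ * ε / 2) (𝓝[<] 1)
      (𝓝 (‖c‖ * (B * 0) - δ * ε / 2)) :=
    (((tendsto_one_sub_rpow hs).const_mul B).const_mul ‖c‖).sub_const _
  have t2 : Tendsto (fun x => -((1 - x) ^ (1 / ε) * |g x₀|)) (𝓝[<] 1) (𝓝 (-(0 * |g x₀|))) :=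
    ((tendsto_one_sub_rpow (by positivity)).mul_const _).neg
  -- Multiplying g(x₀) ≤ g(x) by the weight and letting x → 1 leaves 0 ≤ -δε/2, because both w and
  -- wu tend to 0.
  have hle := le_of_tendsto_of_tendsto t2 t1 (by
    filter_upwards [Ioo_mem_nhdsLT hx₀.2] with x hx
    have hx' : x ∈ Ico x₀ 1 := ⟨hx.1.le, hx.2⟩
    have hm := hmem x hx'
    have hw := weight_pos (ε := ε) hm
    have h1 := hgm ⟨le_rfl, hx₀.2⟩ hx' hx'.1
    have h2 : weight ε x * g x = weight ε x * ((starRingEnd ℂ) c * u x).re - δ * ε / 2 := by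
      simp only [g]
      field_simp
    have h3 : weight ε x * ((starRingEnd ℂ) c * u x).re
        ≤ ‖c‖ * (B * (1 - x) ^ (1 / ε - 1 / 2)) := by
      have h4 : ((starRingEnd ℂ) c * u x).re ≤ ‖c‖ * ‖u x‖ := by
        refine (Complex.re_le_norm _).trans ?_
        rw [norm_mul, RCLike.norm_conj]
      calc weight ε x * ((starRingEnd ℂ) c * u x).re ≤ weight ε x * (‖c‖ * ‖u x‖) := by gcongr
        _ = ‖c‖ * (weight ε x * ‖u x‖) := by ring
        _ ≤ _ := mul_le_mul_of_nonneg_left (norm_weight_mul_le hε0 hB hm) (norm_nonneg _)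
    have h5 : -((1 - x) ^ (1 / ε) * |g x₀|) ≤ weight ε x * g x₀ := by
      have := mul_le_mul_of_nonneg_right (weight_le hε0 hm) (abs_nonneg (g x₀))
      nlinarith [neg_abs_le (g x₀)]
    nlinarith [mul_le_mul_of_nonneg_left h1 hw.le])
  nlinarith [mul_pos hδpos hε0]

/-- A nontrivial solution of `((1 - x²) u')' = (2 / ε) (u' - μ u / x)` on `(0, 1)` that is regular at
`0` and of moderate growth at `1` forces the spectral parameter `μ` to be real and positive. -/
theorem re_pos_of_ode {ε B : ℝ} (hε0 : 0 < ε) (hε2 : ε < 2) {μ : ℂ} {u u' : ℝ → ℂ}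
    (hu : ∀ x ∈ Ioo (0 : ℝ) 1, HasDerivAt u (u' x) x)
    (hp : ∀ x ∈ Ioo (0 : ℝ) 1, HasDerivAt (fun y : ℝ => (1 - (y : ℂ) ^ 2) * u' y)
      (2 / ε * (u' x - μ * u x / x)) x)
    (h0 : Tendsto (fun x : ℝ => (1 - (x : ℂ) ^ 2) * u' x * (starRingEnd ℂ) (u x)) (𝓝[>] 0) (𝓝 0))
    (hB : ∀ x ∈ Ioo (0 : ℝ) 1, ‖u x‖ ≤ B * (1 - x) ^ (-(1 / 2) : ℝ))
    (hne : ∃ x ∈ Ioo (0 : ℝ) 1, u' x ≠ 0) : μ.im = 0 ∧ 0 < μ.re := by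
  have hBnn : 0 ≤ B := by
    have h := (norm_nonneg _).trans (hB (1 / 2) (by norm_num))
    exact nonneg_of_mul_nonneg_left h (Real.rpow_pos_of_pos (by norm_num) _)
  have hsq : ∀ x ∈ Ioo (0 : ℝ) 1, 0 < 1 - x ^ 2 := fun x hx => by nlinarith [hx.1, hx.2]
  -- The self-adjoint form: the weight absorbs the first-order term, so `f'` contains u but not u'.
  let f : ℝ → ℂ := fun x => weight ε x * ((1 - (x : ℂ) ^ 2) * u' x)
  let f' : ℝ → ℂ := fun x => -(2 / ε * μ / x) * (weight ε x * u x)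
  have hf : ∀ x ∈ Ioo (0 : ℝ) 1, HasDerivAt f (f' x) x := by
    intro x hx
    refine ((hasDerivAt_weight hx).ofReal_comp.mul (hp x hx)).congr_deriv ?_
    have h1 : (1 - (x : ℂ) ^ 2) ≠ 0 := by exact_mod_cast (hsq x hx).ne'
    have h2 : (x : ℂ) ≠ 0 := by exact_mod_cast hx.1.ne'
    have h3 : (ε : ℂ) ≠ 0 := by exact_mod_cast hε0.ne'
    simp only [f']
    push_cast
    field_simp
    ring
  have hs : 0 < 1 / ε - 1 / 2 := by
    rw [sub_pos]
    exact one_div_lt_one_div_of_lt hε0 hε2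
  have hK : ∀ x ∈ Ico (1 / 2 : ℝ) 1, ‖f' x‖ ≤ 2 / ε * ‖μ‖ * 2 * B := by
    intro x hx
    have hm : x ∈ Ioo (0 : ℝ) 1 := ⟨by linarith [hx.1], hx.2⟩
    have h1 : ‖(weight ε x : ℂ) * u x‖ ≤ B := by
      rw [norm_mul, Complex.norm_real, Real.norm_of_nonneg (weight_pos hm).le]
      refine (norm_weight_mul_le hε0 hB hm).trans ?_
      refine mul_le_of_le_one_right hBnn ?_
      exact Real.rpow_le_one (by linarith [hx.2]) (by linarith [hx.1]) hs.le
    have h2 : ‖-(2 / ε * μ / x : ℂ)‖ ≤ 2 / ε * ‖μ‖ * 2 := by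
      rw [norm_neg, norm_div, norm_mul, norm_div, Complex.norm_real, Complex.norm_real,
        Real.norm_of_nonneg hε0.le, Real.norm_of_nonneg hm.1.le, Complex.norm_ofNat]
      rw [div_le_iff₀ hm.1]
      have : 0 ≤ 2 / ε * ‖μ‖ := by positivity
      nlinarith [hx.1]
    simp only [f', norm_mul] at h1 h2 ⊢
    exact mul_le_mul h2 h1 (by positivity) (by positivity)
  have hfb := momentum_bound hε0 hε2 hu hf (fun x _ => rfl) hB hK
  set K := 2 / ε * ‖μ‖ * 2 * B
  -- Green's identity in differential form: G' = S - μR with S and R nonnegative. What remains is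
  -- that G vanishes at both ends.
  let G : ℝ → ℂ := fun x => f x * (starRingEnd ℂ) (u x)
  let R : ℝ → ℝ := fun x => weight ε x * ‖u x‖ ^ 2 * (2 / ε) / x
  let S : ℝ → ℝ := fun x => weight ε x * (1 - x ^ 2) * ‖u' x‖ ^ 2
  have hG : ∀ x ∈ Ioo (0 : ℝ) 1, HasDerivAt G (S x - μ * R x) x := by
    intro x hx
    have h2 : (x : ℂ) ≠ 0 := by exact_mod_cast hx.1.ne'
    refine ((hf x hx).mul (hu x hx).star).congr_deriv ?_
    have e1 := Complex.mul_conj (u x)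
    have e2 := Complex.mul_conj (u' x)
    rw [Complex.normSq_eq_norm_sq] at e1 e2
    have e3 : f' x * (starRingEnd ℂ) (u x) = - (2 / ε * μ / x) * weight ε x * (‖u x‖ ^ 2 : ℝ) := by
      rw [← e1]
      simp only [f']
      ring
    have e4 : f x * star (u' x) = weight ε x * (1 - (x : ℂ) ^ 2) * (‖u' x‖ ^ 2 : ℝ) := by
      rw [← e2]
      simp only [f, starRingEnd_apply]
      ring
    simp only [S, R]
    rw [← starRingEnd_apply, e3, e4]
    push_cast
    ring
  have hG0 : Tendsto G (𝓝[>] 0) (𝓝 0) := by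
    rw [tendsto_zero_iff_norm_tendsto_zero] at h0 ⊢
    refine tendsto_of_tendsto_of_tendsto_of_le_of_le' tendsto_const_nhds h0
      (Eventually.of_forall fun x => norm_nonneg _) ?_
    filter_upwards [Ioo_mem_nhdsGT (zero_lt_one' ℝ)] with x hx
    simp only [G, f]
    rw [mul_assoc, norm_mul (weight ε x : ℂ), Complex.norm_real,
      Real.norm_of_nonneg (weight_pos hx).le]
    refine mul_le_of_le_one_left (norm_nonneg _) ((weight_le hε0 hx).trans ?_)
    exact Real.rpow_le_one (by linarith [hx.2]) (by linarith [hx.1]) (by positivity)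
  -- The momentum is O(1-x) and u is O((1-x)^(-1/2)), so G = O((1-x)^(1/2)).
  have hG1 : Tendsto G (𝓝[<] 1) (𝓝 0) := by
    have t : Tendsto (fun x : ℝ => K * B * (1 - x) ^ (1 / 2 : ℝ)) (𝓝[<] 1) (𝓝 (K * B * 0)) :=
      (tendsto_one_sub_rpow (by norm_num)).const_mul _
    rw [mul_zero] at t
    refine squeeze_zero_norm' ?_ t
    filter_upwards [Ioo_mem_nhdsLT (show (1 / 2 : ℝ) < 1 by norm_num)] with x hx
    have ha : 0 < 1 - x := by linarith [hx.2]
    have h1 := hfb x ⟨hx.1.le, hx.2⟩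
    have h2 := hB x ⟨by linarith [hx.1], hx.2⟩
    simp only [G]
    rw [norm_mul, RCLike.norm_conj]
    calc ‖f x‖ * ‖u x‖ ≤ K * (1 - x) * (B * (1 - x) ^ (-(1 / 2) : ℝ)) :=
          mul_le_mul h1 h2 (norm_nonneg _) ((norm_nonneg _).trans h1)
      _ = K * B * (1 - x) ^ (1 / 2 : ℝ) := by
          have : (1 - x) ^ (1 / 2 : ℝ) = (1 - x) * (1 - x) ^ (-(1 / 2) : ℝ) := by
            rw [← Real.rpow_one_add' ha.le (by norm_num)]
            norm_num
          rw [this]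
          ring
  obtain ⟨x₁, hx₁, hne⟩ := hne
  have hS1 : 0 < S x₁ := by
    have := weight_pos (ε := ε) hx₁
    have := hsq x₁ hx₁
    have := norm_pos_iff.2 hne
    simp only [S]
    positivity
  have hRn : ∀ x ∈ Ioo (0 : ℝ) 1, 0 ≤ R x := fun x hx => by
    have := weight_pos (ε := ε) hx
    have := hx.1
    simp only [R]
    positivity
  have hSn : ∀ x ∈ Ioo (0 : ℝ) 1, 0 ≤ S x := fun x hx => by
    have := weight_pos (ε := ε) hx
    have := hsq x hx
    simp only [S]
    positivity
  have hre : ∀ x ∈ Ioo (0 : ℝ) 1, HasDerivAt (fun x => (G x).re) (S x - μ.re * R x) x := by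
    intro x hx
    have := Complex.reCLM.hasFDerivAt.comp_hasDerivAt x (hG x hx)
    exact this.congr_deriv (by simp)
  have him : ∀ x ∈ Ioo (0 : ℝ) 1, HasDerivAt (fun x => (G x).im) (-(μ.im * R x)) x := by
    intro x hx
    have := Complex.imCLM.hasFDerivAt.comp_hasDerivAt x (hG x hx)
    exact this.congr_deriv (by simp)
  have hre0 : Tendsto (fun x => (G x).re) (𝓝[>] 0) (𝓝 0) :=
    (Complex.continuous_re.tendsto 0).comp hG0
  have hre1 : Tendsto (fun x => (G x).re) (𝓝[<] 1) (𝓝 0) :=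
    (Complex.continuous_re.tendsto 0).comp hG1
  have him0 : Tendsto (fun x => (G x).im) (𝓝[>] 0) (𝓝 0) :=
    (Complex.continuous_im.tendsto 0).comp hG0
  have him1 : Tendsto (fun x => (G x).im) (𝓝[<] 1) (𝓝 0) :=
    (Complex.continuous_im.tendsto 0).comp hG1
  -- If Im μ ≠ 0, then Im G is monotone with zero limits, so R = 0, u = 0 and u' = 0. If Re μ ≤ 0,
  -- then Re G is monotone with zero limits, which forces S(x₁) = 0.
  constructor
  · by_contra hμ
    have hR0 : ∀ x ∈ Ioo (0 : ℝ) 1, R x = 0 := by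
      intro x hx
      rcases lt_or_gt_of_ne hμ with h | h
      · have := deriv_eq_zero_of_tendsto_zero him
          (fun y hy => by nlinarith [hRn y hy]) him0 him1 x hx
        simpa [hμ] using this
      · have := deriv_eq_zero_of_tendsto_zero (f := fun x => -(G x).im) (fun y hy => (him y hy).neg)
          (fun y hy => by nlinarith [hRn y hy]) (by simpa using him0.neg) (by simpa using him1.neg)
          x hx
        simpa [hμ] using this
    have hu0 : ∀ x ∈ Ioo (0 : ℝ) 1, u x = 0 := by
      intro x hx
      have h := hR0 x hx
      simp only [R] at h
      have := weight_pos (ε := ε) hx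
      have h2 := hx.1
      simpa [this.ne', h2.ne', hε0.ne'] using h
    have h0 : HasDerivAt u 0 x₁ := (hasDerivAt_const x₁ (0 : ℂ)).congr_of_eventuallyEq
      (by filter_upwards [Ioo_mem_nhds hx₁.1 hx₁.2] with y hy using hu0 y hy)
    exact hne ((hu x₁ hx₁).unique h0)
  · by_contra! hμ
    have := deriv_eq_zero_of_tendsto_zero hre
      (fun y hy => by nlinarith [hRn y hy, hSn y hy]) hre0 hre1 x₁ hx₁
    nlinarith [hRn x₁ hx₁]

/-! ### Power series with polynomially bounded coefficients -/

/-- The sum of the power series with coefficients `c` at a real point. -/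
def powSum (c : ℕ → ℂ) (x : ℝ) : ℂ := ∑' n, c n * (x : ℂ) ^ n

/-- The coefficients of the derived power series. -/
def derivCoeff (c : ℕ → ℂ) (n : ℕ) : ℂ := (n + 1) * c (n + 1)

/-- The sequence `c` grows at most polynomially. -/
def PolyBounded (c : ℕ → ℂ) : Prop := ∃ (C : ℝ) (k : ℕ), ∀ n, ‖c n‖ ≤ C * (n + 1 : ℝ) ^ k

theorem summable_succ_pow_mul_geometric (k : ℕ) {ρ : ℝ} (h0 : 0 < ρ) (h1 : ρ < 1) :
    Summable fun n : ℕ => (n + 1 : ℝ) ^ k * ρ ^ n := by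
  have h := summable_pow_mul_geometric_of_norm_lt_one k
    (show ‖ρ‖ < 1 by rwa [Real.norm_of_nonneg h0.le])
  refine (((summable_nat_add_iff 1).2 h).mul_left ρ⁻¹).congr fun n => ?_
  push_cast
  field_simp
  ring

theorem PolyBounded.succ {c : ℕ → ℂ} (hc : PolyBounded c) : PolyBounded fun n => c (n + 1) := by
  obtain ⟨C, k, h⟩ := hc
  have hC : 0 ≤ C := by simpa using (norm_nonneg _).trans (h 0)
  refine ⟨C * 2 ^ k, k, fun n => (h (n + 1)).trans ?_⟩
  rw [mul_assoc, ← mul_pow]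
  gcongr
  push_cast
  linarith

/-- Polynomial growth survives differentiation, which square summability does not, and still gives
convergence on (-1,1). -/
theorem PolyBounded.derivCoeff {c : ℕ → ℂ} (hc : PolyBounded c) : PolyBounded (derivCoeff c) := by
  obtain ⟨C, k, h⟩ := hc.succ
  refine ⟨C, k + 1, fun n => ?_⟩
  have e : ‖((n : ℂ) + 1)‖ = (n + 1 : ℝ) := by
    rw [← Nat.cast_succ, Complex.norm_natCast, Nat.cast_succ]
  rw [ForwardBackwardHeat.derivCoeff, norm_mul, e, pow_succ]
  nlinarith [mul_le_mul_of_nonneg_left (h n) (show (0 : ℝ) ≤ n + 1 by positivity)]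

theorem PolyBounded.natCast_mul {c : ℕ → ℂ} (hc : PolyBounded c) :
    PolyBounded fun n => n * c n := by
  obtain ⟨C, k, h⟩ := hc
  refine ⟨C, k + 1, fun n => ?_⟩
  rw [norm_mul, Complex.norm_natCast, pow_succ]
  nlinarith [mul_le_mul_of_nonneg_left (h n) (show (0 : ℝ) ≤ n by positivity),
    (norm_nonneg _).trans (h n)]

theorem PolyBounded.exists_summable {c : ℕ → ℂ} (hc : PolyBounded c) {ρ : ℝ} (h0 : 0 < ρ)
    (h1 : ρ < 1) : Summable fun n => ‖c n‖ * ρ ^ n := by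
  obtain ⟨C, k, h⟩ := hc
  refine .of_nonneg_of_le (fun n => by positivity) (fun n => ?_)
    ((summable_succ_pow_mul_geometric k h0 h1).mul_left C)
  rw [← mul_assoc]
  exact mul_le_mul_of_nonneg_right (h n) (by positivity)

theorem PolyBounded.summable {c : ℕ → ℂ} (hc : PolyBounded c) {x : ℝ} (hx : x ∈ Ioo (-1 : ℝ) 1) :
    Summable fun n => c n * (x : ℂ) ^ n := by
  obtain ⟨ρ, h1, h2⟩ := exists_between (abs_lt.2 hx)
  refine .of_norm_bounded (hc.exists_summable ((abs_nonneg x).trans_lt h1) h2) fun n => ?_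
  rw [norm_mul, norm_pow, Complex.norm_real, Real.norm_eq_abs]
  gcongr

theorem PolyBounded.powSum_eq {c : ℕ → ℂ} (hc : PolyBounded c) {x : ℝ}
    (hx : x ∈ Ioo (-1 : ℝ) 1) : powSum c x = c 0 + x * powSum (fun n => c (n + 1)) x := by
  rw [powSum, (hc.summable hx).tsum_eq_zero_add, powSum, ← tsum_mul_left]
  simp only [pow_zero, mul_one]
  congr 2
  ext n
  ring

/-- Termwise differentiation on (-ρ, ρ) with |x| < ρ < 1, the derived terms being dominated by their
size at ρ. -/
theorem PolyBounded.hasDerivAt {c : ℕ → ℂ} (hc : PolyBounded c) {x : ℝ}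
    (hx : x ∈ Ioo (-1 : ℝ) 1) :
    HasDerivAt (powSum c) (powSum (ForwardBackwardHeat.derivCoeff c) x) x := by
  obtain ⟨ρ, h1, h2⟩ := exists_between (abs_lt.2 hx)
  have hρ := (abs_nonneg x).trans_lt h1
  have hb : ∀ y ∈ Ioo (-ρ) ρ, ∀ n : ℕ,
      ‖c n * (n * (y : ℂ) ^ (n - 1))‖ ≤ ‖c n * (n * (ρ : ℂ) ^ (n - 1))‖ := by
    intro y hy n
    simp only [norm_mul, norm_pow, Complex.norm_real, Real.norm_eq_abs, abs_of_pos hρ]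
    have := (abs_lt.2 hy).le
    gcongr
  have hs : Summable fun n : ℕ => ‖c n * (n * (ρ : ℂ) ^ (n - 1))‖ := by
    rw [← summable_nat_add_iff 1]
    refine (hc.derivCoeff.exists_summable hρ h2).congr fun n => ?_
    rw [ForwardBackwardHeat.derivCoeff]
    simp [Real.norm_eq_abs, abs_of_pos hρ]
    ring
  have key := hasDerivAt_tsum_of_isPreconnected (g := fun (n : ℕ) (y : ℝ) => c n * (y : ℂ) ^ n) hs
    isOpen_Ioo isPreconnected_Ioo
    (fun n y _ => by
      simpa using (((hasDerivAt_id y).ofReal_comp).pow n).const_mul (c n))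
    (fun n y hy => hb y hy n) (abs_lt.1 h1) (hc.summable hx) (abs_lt.1 h1)
  refine key.congr_deriv ?_
  rw [(Summable.of_norm_bounded hs (hb x (abs_lt.1 h1))).tsum_eq_zero_add, powSum]
  simp only [CharP.cast_eq_zero, zero_mul, mul_zero, zero_add, add_tsub_cancel_right]
  congr 1
  ext n
  rw [ForwardBackwardHeat.derivCoeff]
  push_cast
  ring

theorem PolyBounded.of_summable_sq {v : ℕ → ℂ} (hv : Summable fun n => ‖v n‖ ^ 2) :
    PolyBounded v := by
  refine ⟨√(∑' n, ‖v n‖ ^ 2), 0, fun n => ?_⟩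
  rw [pow_zero, mul_one]
  exact Real.le_sqrt_of_sq_le (hv.le_tsum n fun _ _ => by positivity)

/-- A power series with square summable coefficients is `O((1 - x)^(-1/2))` at `1`. -/
theorem norm_powSum_le {v : ℕ → ℂ} (hv : Summable fun n => ‖v n‖ ^ 2) {x : ℝ}
    (hx : x ∈ Ioo (0 : ℝ) 1) :
    ‖powSum v x‖ ≤ √(∑' n, ‖v n‖ ^ 2) * (1 - x) ^ (-(1 / 2) : ℝ) := by
  have hx2 : x ^ 2 < 1 := by nlinarith [hx.1, hx.2]
  have hg : HasSum (fun n : ℕ => (x ^ n) ^ 2) (1 - x ^ 2)⁻¹ := by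
    simpa only [← pow_mul, mul_comm _ 2] using hasSum_geometric_of_lt_one (sq_nonneg x) hx2
  -- Cauchy–Schwarz for v against xⁿ, with Σ x²ⁿ = 1/(1-x²) ≤ 1/(1-x).
  have hpq : Real.HolderConjugate 2 2 := by constructor <;> norm_num
  have h1 := Real.summable_mul_of_Lp_Lq_of_nonneg hpq (f := fun n => ‖v n‖)
    (g := fun n => x ^ n) (fun n => norm_nonneg _) (fun n => pow_nonneg hx.1.le n)
    (by simpa using hv) (by simpa using hg.summable)
  have h3 := Real.inner_le_Lp_mul_Lq_tsum_of_nonneg hpq (f := fun n => ‖v n‖)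
    (g := fun n => x ^ n) (fun n => norm_nonneg _) (fun n => pow_nonneg hx.1.le n)
    (by simpa using hv) (by simpa using hg.summable)
  have e : ∀ n, ‖v n * (x : ℂ) ^ n‖ = ‖v n‖ * x ^ n := fun n => by
    rw [norm_mul, norm_pow, Complex.norm_real, Real.norm_of_nonneg hx.1.le]
  have h2 : ‖powSum v x‖ ≤ ∑' n, ‖v n‖ * x ^ n := by
    have hs : Summable fun n => ‖v n * (x : ℂ) ^ n‖ := by simpa only [e] using h1
    simpa only [e, powSum] using norm_tsum_le_tsum_norm hs
  refine h2.trans (h3.trans ?_)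
  simp only [Real.rpow_ofNat]
  rw [hg.tsum_eq, ← Real.sqrt_eq_rpow]
  have ha : 0 < 1 - x := by linarith [hx.2]
  gcongr
  rw [Real.rpow_neg ha.le, ← Real.inv_rpow ha.le]
  have : 1 - x ≤ 1 - x ^ 2 := by nlinarith [hx.1, hx.2]
  gcongr

/-- The three-term recursion for the positive Fourier coefficients of an eigenfunction has a
nontrivial square summable solution only for real and positive spectral parameters. -/
theorem re_pos_of_recursion {ε : ℝ} (hε0 : 0 < ε) (hε2 : ε < 2) {μ : ℂ} {v : ℕ → ℂ}
    (hv : Summable fun n => ‖v n‖ ^ 2) (hv0 : v 0 = 0)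
    (hrec : ∀ n : ℕ, μ * v (n + 1) = (n + 1) * v (n + 1)
      + ε / 2 * ((n + 1) * n * v n - (n + 1) * (n + 2) * v (n + 2)))
    (hne : ∃ n, v n ≠ 0) : μ.im = 0 ∧ 0 < μ.re := by
  have hε : (ε : ℂ) ≠ 0 := by exact_mod_cast hε0.ne'
  have hb := PolyBounded.of_summable_sq hv
  have hd : ∀ x ∈ Ioo (-1 : ℝ) 1, HasDerivAt (powSum v) (powSum (derivCoeff v) x) x :=
    fun x hx => hb.hasDerivAt hx
  have hd2 : ∀ x ∈ Ioo (-1 : ℝ) 1, HasDerivAt (powSum (derivCoeff v))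
      (powSum (derivCoeff (derivCoeff v)) x) x := fun x hx => hb.derivCoeff.hasDerivAt hx
  have hsub : ∀ x ∈ Ioo (0 : ℝ) 1, x ∈ Ioo (-1 : ℝ) 1 := fun x hx => ⟨by linarith [hx.1], hx.2⟩
  have hm0 : (0 : ℝ) ∈ Ioo (-1 : ℝ) 1 := by norm_num
  refine re_pos_of_ode hε0 hε2 (u := powSum v) (u' := powSum (derivCoeff v))
    (fun x hx => hd x (hsub x hx)) (fun x hx => ?_) ?_ (fun x hx => norm_powSum_le hv hx) ?_
  · have hx' := hsub x hx
    have hx0 : (x : ℂ) ≠ 0 := by exact_mod_cast hx.1.ne'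
    have h1 : HasDerivAt (fun y : ℝ => (1 : ℂ) - (y : ℂ) ^ 2) (-(2 * x) : ℂ) x := by
      simpa using (((hasDerivAt_id x).ofReal_comp).pow 2).const_sub 1
    refine (h1.mul (hd2 x hx')).congr_deriv ?_
    -- Because v₀ = 0, the quotient u/x is again a power series, with shifted coefficients.
    have e0 : powSum v x = x * powSum (fun n => v (n + 1)) x := by
      rw [hb.powSum_eq hx', hv0, zero_add]
    have s1 := hb.derivCoeff.summable hx'
    have s2 := hb.derivCoeff.derivCoeff.summable hx'
    have s3 := hb.derivCoeff.natCast_mul.summable hx'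
    have s4 := hb.succ.summable hx'
    have s5 := (hb.natCast_mul.natCast_mul.summable hx').add (hb.natCast_mul.summable hx')
    have e1 : x * powSum (derivCoeff (derivCoeff v)) x
        = ∑' n : ℕ, n * derivCoeff v n * (x : ℂ) ^ n := by
      have := hb.derivCoeff.natCast_mul.powSum_eq hx'
      simp only [CharP.cast_eq_zero, zero_mul, zero_add, Nat.cast_add, Nat.cast_one] at this
      exact this.symm
    have e2 : x * (2 * powSum (derivCoeff v) x + x * powSum (derivCoeff (derivCoeff v)) x)
        = ∑' n : ℕ, (n * (n * v n) * (x : ℂ) ^ n + n * v n * (x : ℂ) ^ n) := by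
      rw [e1, s5.tsum_eq_zero_add, powSum, ← tsum_mul_left, ← (s1.mul_left 2).tsum_add s3,
        ← tsum_mul_left]
      simp only [CharP.cast_eq_zero, zero_mul, zero_add]
      congr 1
      ext n
      simp only [derivCoeff]
      push_cast
      ring
    -- Comparing coefficients of xⁿ in u'' - (x²u'' + 2xu') = (2/ε)(u' - μu/x) gives exactly the
    -- recursion.
    have e3 : powSum (derivCoeff (derivCoeff v)) x
        - ∑' n : ℕ, (n * (n * v n) * (x : ℂ) ^ n + n * v n * (x : ℂ) ^ n)
        = 2 / ε * (powSum (derivCoeff v) x - μ * powSum (fun n => v (n + 1)) x) := by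
      rw [powSum, powSum, powSum, ← tsum_mul_left (a := μ), ← s1.tsum_sub (s4.mul_left μ),
        ← s2.tsum_sub s5, ← tsum_mul_left]
      congr 1
      ext n
      have h := hrec n
      simp only [derivCoeff]
      push_cast
      rw [← mul_assoc μ, h]
      field_simp
      ring
    rw [e0, mul_left_comm, mul_div_cancel_left₀ _ hx0, ← e3, ← e2]
    ring
  · have hc : ContinuousAt (fun x : ℝ => (1 - (x : ℂ) ^ 2) * powSum (derivCoeff v) x
        * (starRingEnd ℂ) (powSum v x)) 0 := by
      have c1 := (hd 0 hm0).continuousAt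
      have c2 := (hd2 0 hm0).continuousAt
      have c3 : ContinuousAt (fun x : ℝ => 1 - (x : ℂ) ^ 2) 0 := by fun_prop
      exact (c3.mul c2).mul (RCLike.continuous_conj.continuousAt.comp c1)
    have h := hc.tendsto
    rw [show powSum v 0 = 0 by rw [hb.powSum_eq hm0, hv0]; simp, map_zero, mul_zero] at h
    exact h.mono_left nhdsWithin_le_nhds
  -- If u' vanished on (0,1), then v₁ = u'(0) = 0. With v₀ = 0 the recursion then annihilates every
  -- coefficient, as the factor of v (n + 2) is never zero.
  · by_contra! hz
    have h1 : v 1 = 0 := by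
      have t1 : Tendsto (powSum (derivCoeff v)) (𝓝[>] 0) (𝓝 (powSum (derivCoeff v) 0)) :=
        (hd2 0 hm0).continuousAt.tendsto.mono_left nhdsWithin_le_nhds
      have t2 : Tendsto (powSum (derivCoeff v)) (𝓝[>] 0) (𝓝 0) := by
        refine tendsto_const_nhds.congr' ?_
        filter_upwards [Ioo_mem_nhdsGT (zero_lt_one' ℝ)] with x hx using (hz x hx).symm
      have h := tendsto_nhds_unique t1 t2
      rw [hb.derivCoeff.powSum_eq hm0] at h
      simpa [derivCoeff] using h
    have hall : ∀ n, v n = 0 ∧ v (n + 1) = 0 := by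
      intro n
      induction n with
      | zero => exact ⟨hv0, h1⟩
      | succ n ih =>
        refine ⟨ih.2, ?_⟩
        have h := hrec n
        rw [ih.1, ih.2] at h
        have a1 : ((n : ℂ) + 1) ≠ 0 := by exact_mod_cast n.succ_ne_zero
        have a2 : ((n : ℂ) + 2) ≠ 0 := by exact_mod_cast (n + 1).succ_ne_zero
        simpa [hε, a1, a2] using h
    obtain ⟨n, hn⟩ := hne
    exact hn (hall n).1

/-! ### Integration by parts up to the end points -/

theorem integrable_mul_of_continuous {ψ : ℝ → ℂ} (hψ : Continuous ψ) (h : L2) :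
    Integrable (fun θ => ψ θ * h θ) arc :=
  (memLp_of_continuous hψ).integrable_mul (Lp.memLp h)

theorem integral_arc_eq_intervalIntegral {E : Type*} [NormedAddCommGroup E] [NormedSpace ℝ E]
    (f : ℝ → E) : ∫ θ, f θ ∂arc = ∫ θ in -Real.pi..Real.pi, f θ := by
  rw [intervalIntegral.integral_of_le (by linarith [Real.pi_pos]), integral_Ioc_eq_integral_Ioo]

/-- A complex test function may be used in the definition of the weak derivative. -/
theorem IsWeakDeriv.integral_mul {h g : L2} (H : IsWeakDeriv h g) {φ : ℝ → ℂ}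
    (h1 : ContDiff ℝ ∞ φ) (h2 : HasCompactSupport φ)
    (h3 : tsupport φ ⊆ Ioo (-Real.pi) Real.pi) :
    ∫ θ, deriv φ θ * h θ ∂arc = - ∫ θ, φ θ * g θ ∂arc := by
  have hdφ : ∀ θ, HasDerivAt φ (deriv φ θ) θ := fun θ => (h1.differentiable (by simp) θ).hasDerivAt
  have key : ∀ P : ℂ →L[ℝ] ℝ, ∫ θ, (P (deriv φ θ) : ℂ) * h θ ∂arc
      = - ∫ θ, (P (φ θ) : ℂ) * g θ ∂arc := by
    intro P
    have e : deriv (fun θ => P (φ θ)) = fun θ => P (deriv φ θ) :=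
      funext fun θ => (P.hasFDerivAt.comp_hasDerivAt θ (hdφ θ)).deriv
    have hs : Function.support (fun θ => P (φ θ)) ⊆ Function.support φ := by
      intro θ hθ hz
      exact hθ (by simp [hz])
    have := H (fun θ => P (φ θ)) (P.contDiff.comp h1) (h2.mono hs) ((closure_mono hs).trans h3)
    rw [e] at this
    simpa only [Complex.real_smul] using this
  have hc := h1.continuous
  have hcd : Continuous (deriv φ) := h1.continuous_deriv (by simp)
  have split : ∀ (ψ : ℝ → ℂ) (f : L2), Continuous ψ → ∫ θ, ψ θ * f θ ∂arc
      = (∫ θ, (Complex.reCLM (ψ θ) : ℂ) * f θ ∂arc)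
        + Complex.I * ∫ θ, (Complex.imCLM (ψ θ) : ℂ) * f θ ∂arc := by
    intro ψ f hψ
    rw [← integral_const_mul, ← integral_add]
    · refine integral_congr_ae (Eventually.of_forall fun θ => ?_)
      simp only [Complex.reCLM_apply, Complex.imCLM_apply]
      conv_lhs => rw [← Complex.re_add_im (ψ θ)]
      ring
    · exact integrable_mul_of_continuous (by fun_prop) f
    · exact (integrable_mul_of_continuous (by fun_prop) f).const_mul _
  rw [split _ h hcd, split _ g hc, key, key]
  ring

/-! ### Cutoff functions and the vanishing of boundary terms. -/

theorem smoothTransition_deriv_nonneg (y : ℝ) : 0 ≤ deriv Real.smoothTransition y :=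
  Real.smoothTransition.monotone.deriv_nonneg

theorem smoothTransition_deriv_eq_zero {y : ℝ} (hy : y ∉ Icc (0 : ℝ) 1) :
    deriv Real.smoothTransition y = 0 := by
  rcases not_and_or.1 hy with h | h
  · have : Real.smoothTransition =ᶠ[𝓝 y] fun _ => 0 := by
      filter_upwards [Iio_mem_nhds (not_le.1 h)] with x hx
      exact Real.smoothTransition.zero_of_nonpos (le_of_lt hx)
    rw [this.deriv_eq, deriv_const]
  · have : Real.smoothTransition =ᶠ[𝓝 y] fun _ => 1 := by
      filter_upwards [Ioi_mem_nhds (not_le.1 h)] with x hx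
      exact Real.smoothTransition.one_of_one_le (le_of_lt hx)
    rw [this.deriv_eq, deriv_const]

theorem exists_smoothTransition_deriv_le : ∃ C, 0 ≤ C ∧ ∀ y, deriv Real.smoothTransition y ≤ C := by
  have hc : Continuous (deriv Real.smoothTransition) :=
    (Real.smoothTransition.contDiff (n := 1)).continuous_deriv (by simp)
  obtain ⟨C, hC⟩ := (isCompact_Icc (a := (0 : ℝ)) (b := 1)).exists_bound_of_continuousOn
    hc.continuousOn
  have hC0 : 0 ≤ C := (norm_nonneg _).trans (hC 0 (by norm_num))
  refine ⟨C, hC0, fun y => ?_⟩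
  by_cases hy : y ∈ Icc (0 : ℝ) 1
  · exact (le_abs_self _).trans (hC y hy)
  · rwa [smoothTransition_deriv_eq_zero hy]

/-- Smooth cutoff functions exhausting `(-π, π)`. -/
def cutoff (n : ℕ) (x : ℝ) : ℝ := Real.smoothTransition (n * (Real.pi ^ 2 - x ^ 2) - 1)

/-- The derivative of `cutoff n`. -/
def cutoffDeriv (n : ℕ) (x : ℝ) : ℝ :=
  deriv Real.smoothTransition (n * (Real.pi ^ 2 - x ^ 2) - 1) * (n * (-(2 * x)))

theorem contDiff_cutoff (n : ℕ) : ContDiff ℝ ∞ (cutoff n) :=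
  Real.smoothTransition.contDiff.comp
    ((contDiff_const.mul (contDiff_const.sub (contDiff_id.pow 2))).sub contDiff_const)

theorem hasDerivAt_cutoff (n : ℕ) (x : ℝ) : HasDerivAt (cutoff n) (cutoffDeriv n x) x := by
  have h : HasDerivAt (fun x : ℝ => n * (Real.pi ^ 2 - x ^ 2) - 1) (n * (-(2 * x))) x := by
    simpa using ((((hasDerivAt_id x).pow 2).const_sub (Real.pi ^ 2)).const_mul (n : ℝ)).sub_const 1
  exact (((Real.smoothTransition.contDiff (n := 1)).differentiable (by simp) _).hasDerivAt).comp x h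

theorem continuous_cutoffDeriv (n : ℕ) : Continuous (cutoffDeriv n) := by
  have hc : Continuous (deriv Real.smoothTransition) :=
    (Real.smoothTransition.contDiff (n := 1)).continuous_deriv (by simp)
  exact (hc.comp (by fun_prop)).mul (by fun_prop)

theorem tsupport_cutoff_subset {n : ℕ} (hn : 0 < n) :
    tsupport (cutoff n) ⊆ Ioo (-Real.pi) Real.pi := by
  have hcl : IsClosed {x : ℝ | 1 ≤ n * (Real.pi ^ 2 - x ^ 2)} :=
    isClosed_le continuous_const (by fun_prop)
  refine (closure_minimal (fun x hx => ?_) hcl).trans fun x hx => ?_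
  · by_contra hlt
    refine hx (Real.smoothTransition.zero_of_nonpos ?_)
    linarith [not_le.1 (show ¬(1 : ℝ) ≤ n * (Real.pi ^ 2 - x ^ 2) from hlt)]
  · have h0 : (0 : ℝ) < n := by exact_mod_cast hn
    have h1 : 0 < n * (Real.pi ^ 2 - x ^ 2) := lt_of_lt_of_le one_pos hx
    have h2 : 0 < Real.pi ^ 2 - x ^ 2 := pos_of_mul_pos_right h1 h0.le
    exact abs_lt.1 (abs_lt_of_sq_lt_sq (by linarith) Real.pi_pos.le)

theorem hasCompactSupport_cutoff {n : ℕ} (hn : 0 < n) : HasCompactSupport (cutoff n) :=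
  isCompact_Icc.of_isClosed_subset (isClosed_tsupport _)
    ((tsupport_cutoff_subset hn).trans Ioo_subset_Icc_self)

theorem cutoff_mem_Icc (n : ℕ) (x : ℝ) : cutoff n x ∈ Icc (0 : ℝ) 1 :=
  ⟨Real.smoothTransition.nonneg _, Real.smoothTransition.le_one _⟩

theorem tendsto_mul_pi_sq_sub {x : ℝ} (hx : x ∈ Ioo (-Real.pi) Real.pi) :
    Tendsto (fun n : ℕ => n * (Real.pi ^ 2 - x ^ 2) - 1) atTop atTop := by
  have h : 0 < Real.pi ^ 2 - x ^ 2 := by nlinarith [hx.1, hx.2]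
  exact tendsto_atTop_add_const_right _ _ (tendsto_natCast_atTop_atTop.atTop_mul_const h)

theorem cutoff_eventually_one {x : ℝ} (hx : x ∈ Ioo (-Real.pi) Real.pi) :
    ∀ᶠ n : ℕ in atTop, cutoff n x = 1 := by
  filter_upwards [(tendsto_mul_pi_sq_sub hx).eventually_ge_atTop 1] with n hn
  exact Real.smoothTransition.one_of_one_le hn

theorem cutoffDeriv_eventually_zero {x : ℝ} (hx : x ∈ Ioo (-Real.pi) Real.pi) :
    ∀ᶠ n : ℕ in atTop, cutoffDeriv n x = 0 := by
  filter_upwards [(tendsto_mul_pi_sq_sub hx).eventually_gt_atTop 1] with n hn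
  rw [cutoffDeriv, smoothTransition_deriv_eq_zero (fun h => absurd h.2 (not_le.2 hn)), zero_mul]

/-- `cutoffDeriv n` is carried by the points at distance at most `1 / n` from the end points. -/
theorem mul_sub_abs_le_of_cutoffDeriv_ne_zero {n : ℕ} {x : ℝ} (hx : x ∈ Ioo (-Real.pi) Real.pi)
    (h : cutoffDeriv n x ≠ 0) : n * Real.pi * (Real.pi - |x|) ≤ 2 := by
  have h1 : n * (Real.pi ^ 2 - x ^ 2) - 1 ∈ Icc (0 : ℝ) 1 := by
    by_contra hy
    exact h (by rw [cutoffDeriv, smoothTransition_deriv_eq_zero hy, zero_mul])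
  have h2 : Real.pi * (Real.pi - |x|) ≤ Real.pi ^ 2 - x ^ 2 := by
    have h3 : |x| < Real.pi := abs_lt.2 hx
    nlinarith [abs_nonneg x, sq_abs x]
  have := mul_le_mul_of_nonneg_left h2 (Nat.cast_nonneg (α := ℝ) n)
  nlinarith [h1.2]

theorem abs_sin_le_pi_sub_abs {x : ℝ} (hx : x ∈ Ioo (-Real.pi) Real.pi) :
    |Real.sin x| ≤ Real.pi - |x| := by
  have h3 : |x| < Real.pi := abs_lt.2 hx
  have h : |Real.sin x| = |Real.sin (Real.pi - |x|)| := by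
    rw [Real.sin_pi_sub]
    rcases abs_choice x with h | h <;> rw [h]
    rw [Real.sin_neg, abs_neg]
  rw [h]
  exact (Real.abs_sin_le_abs).trans (abs_of_pos (by linarith)).le

/-- The derivative of the cutoff is O(n), but it lives within O(1/n) of the end points, where the
sine is O(1/n). The bound is uniform in n and serves as a dominating constant. -/
theorem exists_sin_mul_cutoffDeriv_le : ∃ C, ∀ (n : ℕ), ∀ x ∈ Ioo (-Real.pi) Real.pi,
    |Real.sin x * cutoffDeriv n x| ≤ C := by
  obtain ⟨C, hC0, hC⟩ := exists_smoothTransition_deriv_le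
  refine ⟨4 * C, fun n x hx => ?_⟩
  by_cases h0 : cutoffDeriv n x = 0
  · rw [h0, mul_zero, abs_zero]
    positivity
  have h3 : |x| < Real.pi := abs_lt.2 hx
  have h1 := mul_sub_abs_le_of_cutoffDeriv_ne_zero hx h0
  have h2 := abs_sin_le_pi_sub_abs hx
  have hT := smoothTransition_deriv_nonneg (n * (Real.pi ^ 2 - x ^ 2) - 1)
  have e : |cutoffDeriv n x|
      = deriv Real.smoothTransition (n * (Real.pi ^ 2 - x ^ 2) - 1) * (n * (2 * |x|)) := by
    rw [cutoffDeriv, abs_mul, abs_of_nonneg hT, abs_mul, abs_neg, abs_mul, Nat.abs_cast, abs_two]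
  rw [abs_mul, e]
  calc |Real.sin x| * (deriv Real.smoothTransition (n * (Real.pi ^ 2 - x ^ 2) - 1) * (n * (2 * |x|)))
      ≤ (Real.pi - |x|) * (C * (n * (2 * Real.pi))) := by
        refine mul_le_mul h2 ?_ (by positivity) (by linarith)
        exact mul_le_mul (hC _) (by gcongr) (by positivity) hC0
    _ = 2 * C * (n * Real.pi * (Real.pi - |x|)) := by ring
    _ ≤ 4 * C := by nlinarith

theorem integral_cutoffDeriv (n : ℕ) (a b : ℝ) :
    ∫ x in a..b, cutoffDeriv n x = cutoff n b - cutoff n a :=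
  intervalIntegral.integral_eq_sub_of_hasDerivAt (fun x _ => hasDerivAt_cutoff n x)
    ((continuous_cutoffDeriv n).intervalIntegrable a b)

theorem cutoff_eq_zero {n : ℕ} {x : ℝ} (hx : x ^ 2 = Real.pi ^ 2) : cutoff n x = 0 :=
  Real.smoothTransition.zero_of_nonpos (by rw [hx]; simp)

/-- The cutoff rises on [-π, 0] and falls on [0, π] with values in [0,1], so its total variation is
at most 2. -/
theorem integral_abs_cutoffDeriv_le (n : ℕ) : ∫ x, |cutoffDeriv n x| ∂arc ≤ 2 := by
  have hc := (continuous_cutoffDeriv n).abs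
  rw [integral_arc_eq_intervalIntegral, ← intervalIntegral.integral_add_adjacent_intervals
    (hc.intervalIntegrable (-Real.pi) 0) (hc.intervalIntegrable 0 Real.pi)]
  have h1 : ∫ x in -Real.pi..0, |cutoffDeriv n x| = ∫ x in -Real.pi..0, cutoffDeriv n x := by
    refine intervalIntegral.integral_congr fun x hx => ?_
    rw [uIcc_of_le (by linarith [Real.pi_pos])] at hx
    refine abs_of_nonneg (mul_nonneg (smoothTransition_deriv_nonneg _) ?_)
    exact mul_nonneg (Nat.cast_nonneg _) (by linarith [hx.2])
  have h2 : ∫ x in 0..Real.pi, |cutoffDeriv n x| = ∫ x in 0..Real.pi, -cutoffDeriv n x := by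
    refine intervalIntegral.integral_congr fun x hx => ?_
    rw [uIcc_of_le Real.pi_pos.le] at hx
    refine abs_of_nonpos (mul_nonpos_of_nonneg_of_nonpos (smoothTransition_deriv_nonneg _) ?_)
    exact mul_nonpos_of_nonneg_of_nonpos (Nat.cast_nonneg _) (by linarith [hx.1])
  rw [h1, h2, intervalIntegral.integral_neg, integral_cutoffDeriv, integral_cutoffDeriv,
    cutoff_eq_zero (neg_sq _), cutoff_eq_zero rfl]
  linarith [(cutoff_mem_Icc n 0).2]

theorem tendsto_integral_cutoff_mul {w : ℝ → ℂ} (hw : Integrable w arc) :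
    Tendsto (fun n : ℕ => ∫ θ, (cutoff n θ : ℂ) * w θ ∂arc) atTop (𝓝 (∫ θ, w θ ∂arc)) := by
  refine tendsto_integral_of_dominated_convergence (fun θ => ‖w θ‖) (fun n => ?_) hw.norm
    (fun n => Eventually.of_forall fun θ => ?_) ?_
  · exact (Complex.continuous_ofReal.comp (contDiff_cutoff n).continuous).aestronglyMeasurable.mul
      hw.aestronglyMeasurable
  · rw [norm_mul, Complex.norm_real, Real.norm_of_nonneg (cutoff_mem_Icc n θ).1]
    exact mul_le_of_le_one_left (norm_nonneg _) (cutoff_mem_Icc n θ).2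
  · filter_upwards [ae_restrict_mem measurableSet_Ioo] with θ hθ
    refine tendsto_const_nhds.congr' ?_
    filter_upwards [cutoff_eventually_one hθ] with n hn
    rw [hn, Complex.ofReal_one, one_mul]

theorem tendsto_integral_sin_mul_cutoffDeriv_mul {w : ℝ → ℂ} (hw : Integrable w arc) :
    Tendsto (fun n : ℕ => ∫ θ, ((Real.sin θ * cutoffDeriv n θ : ℝ) : ℂ) * w θ ∂arc) atTop
      (𝓝 0) := by
  obtain ⟨C, hC⟩ := exists_sin_mul_cutoffDeriv_le
  rw [← integral_zero ℝ ℂ (μ := arc)]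
  refine tendsto_integral_of_dominated_convergence (fun θ => C * ‖w θ‖) (fun n => ?_)
    (hw.norm.const_mul C) (fun n => ?_) ?_
  · exact (Complex.continuous_ofReal.comp
      (Real.continuous_sin.mul (continuous_cutoffDeriv n))).aestronglyMeasurable.mul
      hw.aestronglyMeasurable
  · filter_upwards [ae_restrict_mem measurableSet_Ioo] with θ hθ
    rw [norm_mul, Complex.norm_real]
    exact mul_le_mul_of_nonneg_right (hC n θ hθ) (norm_nonneg _)
  · filter_upwards [ae_restrict_mem measurableSet_Ioo] with θ hθ
    refine tendsto_const_nhds.congr' ?_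
    filter_upwards [cutoffDeriv_eventually_zero hθ] with n hn
    rw [hn, mul_zero, Complex.ofReal_zero, zero_mul]

/-- `cutoffDeriv n` approximates the point mass at -π minus the one at π, so the limit is F(-π) -
F(π), which is zero by periodicity. -/
theorem tendsto_integral_cutoffDeriv_mul {F : ℝ → ℂ}
    (hF : ContinuousOn F (Icc (-Real.pi) Real.pi)) (hp : F (-Real.pi) = F Real.pi) :
    Tendsto (fun n : ℕ => ∫ θ, (cutoffDeriv n θ : ℂ) * F θ ∂arc) atTop (𝓝 0) := by
  have hpi := Real.pi_pos
  rw [Metric.tendsto_atTop]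
  intro η hη
  obtain ⟨d₁, hd₁, h₁⟩ := Metric.continuousOn_iff.1 hF Real.pi (by constructor <;> linarith)
    (η / 4) (by positivity)
  obtain ⟨d₂, hd₂, h₂⟩ := Metric.continuousOn_iff.1 hF (-Real.pi) (by constructor <;> linarith)
    (η / 4) (by positivity)
  obtain ⟨N, hN⟩ := exists_nat_gt (2 / (Real.pi * min d₁ d₂))
  have hd : 0 < min d₁ d₂ := lt_min hd₁ hd₂
  refine ⟨N, fun n hn => ?_⟩
  have hn' : 2 < n * Real.pi * min d₁ d₂ := by
    rw [mul_assoc, ← div_lt_iff₀ (by positivity)]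
    exact hN.trans_le (by exact_mod_cast hn)
  have hcd := continuous_cutoffDeriv n
  have hcd' : Continuous fun θ => (cutoffDeriv n θ : ℂ) := Complex.continuous_ofReal.comp hcd
  have i1 : Integrable (fun θ => (cutoffDeriv n θ : ℂ) * F θ) arc :=
    ((hcd'.continuousOn.mul hF).integrableOn_Icc).mono_set Ioo_subset_Icc_self
  have i2 : Integrable (fun θ => (cutoffDeriv n θ : ℂ) * F Real.pi) arc :=
    ((hcd'.mul continuous_const).integrableOn_Icc).mono_set Ioo_subset_Icc_self
  have i3 : Integrable (fun θ => |cutoffDeriv n θ|) arc :=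
    (hcd.abs.integrableOn_Icc).mono_set Ioo_subset_Icc_self
  -- The cutoff vanishes at both end points, so the constant F(π) may be subtracted; near either end
  -- point F is then small by continuity and periodicity.
  have e : ∫ θ, (cutoffDeriv n θ : ℂ) * F Real.pi ∂arc = 0 := by
    rw [integral_mul_const, integral_complex_ofReal, integral_arc_eq_intervalIntegral,
      integral_cutoffDeriv, cutoff_eq_zero (neg_sq _), cutoff_eq_zero rfl]
    simp
  rw [dist_zero_right, ← sub_zero (∫ θ, (cutoffDeriv n θ : ℂ) * F θ ∂arc), ← e,
    ← integral_sub i1 i2]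
  have hbd : ∀ᵐ θ ∂arc, ‖(cutoffDeriv n θ : ℂ) * F θ - (cutoffDeriv n θ : ℂ) * F Real.pi‖
      ≤ |cutoffDeriv n θ| * (η / 4) := by
    filter_upwards [ae_restrict_mem measurableSet_Ioo] with θ hθ
    rw [← mul_sub, norm_mul, Complex.norm_real, Real.norm_eq_abs]
    by_cases h0 : cutoffDeriv n θ = 0
    · simp [h0]
    refine mul_le_mul_of_nonneg_left ?_ (abs_nonneg _)
    have h := mul_sub_abs_le_of_cutoffDeriv_ne_zero hθ h0
    have hlt : Real.pi - |θ| < min d₁ d₂ := by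
      have := h.trans_lt hn'
      exact lt_of_mul_lt_mul_left this (by positivity)
    rcases le_total 0 θ with hs | hs
    · rw [abs_of_nonneg hs] at hlt
      have := h₁ θ (Ioo_subset_Icc_self hθ) (by
        rw [Real.dist_eq, abs_sub_comm, abs_of_pos (by linarith [hθ.2])]
        exact hlt.trans_le (min_le_left _ _))
      rw [dist_eq_norm] at this
      exact this.le
    · rw [abs_of_nonpos hs] at hlt
      have := h₂ θ (Ioo_subset_Icc_self hθ) (by
        rw [Real.dist_eq, abs_of_pos (by linarith [hθ.1])]
        exact lt_of_lt_of_le (by linarith) (min_le_right d₁ d₂))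
      rw [dist_eq_norm, hp] at this
      exact this.le
  refine (norm_integral_le_of_norm_le (i3.mul_const _) hbd).trans_lt ?_
  rw [integral_mul_const]
  nlinarith [integral_abs_cutoffDeriv_le n]

/-- The weak derivative tested on the cutoff times ψ. The first integral is the boundary term, which
disappears as n → ∞ either by periodicity or through a factor sin θ. -/
theorem integral_deriv_cutoff_mul {h g : L2} (H : IsWeakDeriv h g) {ψ : ℝ → ℂ}
    (hψ : ContDiff ℝ ∞ ψ) {n : ℕ} (hn : 0 < n) :
    (∫ θ, (cutoffDeriv n θ : ℂ) * (ψ θ * h θ) ∂arc)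
      + ∫ θ, (cutoff n θ : ℂ) * (deriv ψ θ * h θ) ∂arc
      = - ∫ θ, (cutoff n θ : ℂ) * (ψ θ * g θ) ∂arc := by
  have hc : ContDiff ℝ ∞ fun θ => (cutoff n θ : ℂ) :=
    Complex.ofRealCLM.contDiff.comp (contDiff_cutoff n)
  have hs : Function.support (fun θ => (cutoff n θ : ℂ) * ψ θ) ⊆ Function.support (cutoff n) := by
    intro θ hθ hz
    exact hθ (by simp [hz])
  have hd : deriv (fun θ => (cutoff n θ : ℂ) * ψ θ)
      = fun θ => (cutoffDeriv n θ : ℂ) * ψ θ + cutoff n θ * deriv ψ θ := by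
    ext θ
    exact ((hasDerivAt_cutoff n θ).ofReal_comp.mul
      (hψ.differentiable (by simp) θ).hasDerivAt).deriv
  have key := H.integral_mul (hc.mul hψ) ((hasCompactSupport_cutoff hn).mono hs)
    ((closure_mono hs).trans (tsupport_cutoff_subset hn))
  have hdc : Continuous (deriv ψ) := hψ.continuous_deriv (by simp)
  have hcd : Continuous fun θ => (cutoffDeriv n θ : ℂ) :=
    Complex.continuous_ofReal.comp (continuous_cutoffDeriv n)
  rw [hd] at key
  rw [← integral_add]
  · simp only [← mul_assoc, ← add_mul]
    exact key
  · simp only [← mul_assoc]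
    exact integrable_mul_of_continuous (hcd.mul hψ.continuous) h
  · simp only [← mul_assoc]
    exact integrable_mul_of_continuous (hc.continuous.mul hdc) h

/-- Integration by parts for a periodic Sobolev function against a periodic smooth function. -/
theorem IsWeakDeriv.integral_mul_of_isPeriodic {h g : L2} (H : IsWeakDeriv h g)
    (hp : IsPeriodic h) {ψ : ℝ → ℂ} (hψ : ContDiff ℝ ∞ ψ) (hψp : ψ (-Real.pi) = ψ Real.pi) :
    ∫ θ, ψ θ * g θ ∂arc = - ∫ θ, deriv ψ θ * h θ ∂arc := by
  obtain ⟨F, hF, hFp, hae⟩ := hp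
  have hdc : Continuous (deriv ψ) := hψ.continuous_deriv (by simp)
  have t1 := tendsto_integral_cutoffDeriv_mul (hψ.continuous.continuousOn.mul hF)
    (by simp [hψp, hFp])
  have t2 := tendsto_integral_cutoff_mul (integrable_mul_of_continuous hdc h)
  have t3 := tendsto_integral_cutoff_mul (integrable_mul_of_continuous hψ.continuous g)
  have e : ∀ n : ℕ, ∫ θ, (cutoffDeriv n θ : ℂ) * (ψ θ * F θ) ∂arc
      = ∫ θ, (cutoffDeriv n θ : ℂ) * (ψ θ * h θ) ∂arc := fun n =>
    integral_congr_ae (hae.mono fun θ hθ => by simp only [hθ])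
  have t4 := tendsto_nhds_unique ((t1.add t2).congr' ?_) t3.neg
  · rw [zero_add] at t4
    rw [t4, neg_neg]
  · filter_upwards [eventually_gt_atTop 0] with n hn
    rw [← integral_deriv_cutoff_mul H hψ hn, ← e n]
    rfl

/-- Integration by parts for a Sobolev function of the form `sin(θ) g`, which needs no boundary
terms. -/
theorem IsWeakDeriv.integral_mul_of_sinMul {g k : L2} (H : IsWeakDeriv (sinMul g) k)
    {ψ : ℝ → ℂ} (hψ : ContDiff ℝ ∞ ψ) :
    ∫ θ, ψ θ * k θ ∂arc = - ∫ θ, deriv ψ θ * (Real.sin θ * g θ) ∂arc := by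
  have hdc : Continuous (deriv ψ) := hψ.continuous_deriv (by simp)
  have t1 := tendsto_integral_sin_mul_cutoffDeriv_mul (integrable_mul_of_continuous hψ.continuous g)
  have t2 := tendsto_integral_cutoff_mul (integrable_mul_of_continuous hdc (sinMul g))
  have t3 := tendsto_integral_cutoff_mul (integrable_mul_of_continuous hψ.continuous k)
  have e : ∀ n : ℕ, ∫ θ, ((Real.sin θ * cutoffDeriv n θ : ℝ) : ℂ) * (ψ θ * g θ) ∂arc
      = ∫ θ, (cutoffDeriv n θ : ℂ) * (ψ θ * sinMul g θ) ∂arc := fun n =>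
    integral_congr_ae ((sinMul_ae g).mono fun θ hθ => by
      simp only [hθ]
      push_cast
      ring)
  have t4 := tendsto_nhds_unique ((t1.add t2).congr' ?_) t3.neg
  · rw [zero_add] at t4
    rw [← neg_eq_iff_eq_neg, ← t4]
    exact integral_congr_ae ((sinMul_ae g).mono fun θ hθ => by simp only [hθ])
  · filter_upwards [eventually_gt_atTop 0] with n hn
    rw [← integral_deriv_cutoff_mul H hψ hn, ← e n]

/-! ### Fourier coefficients -/

theorem contDiff_expMode (n : ℤ) : ContDiff ℝ ∞ (expMode n) :=
  contDiff_of_mem (Submodule.subset_span ⟨n, rfl⟩)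

theorem deriv_expMode (n : ℤ) (θ : ℝ) : deriv (expMode n) θ = n * Complex.I * expMode n θ := by
  have h : HasDerivAt (fun θ : ℝ => (n : ℂ) * θ * Complex.I) (n * 1 * Complex.I) θ :=
    (((hasDerivAt_id θ).ofReal_comp).const_mul (n : ℂ)).mul_const Complex.I
  have := h.cexp.deriv
  simp only [mul_one] at this
  rw [mul_comm]
  exact this

theorem conj_expMode (n : ℤ) (θ : ℝ) : (starRingEnd ℂ) (expMode n θ) = expMode (-n) θ := by
  simp only [expMode, ← Complex.exp_conj, map_mul, Complex.conj_I, Complex.conj_ofReal, map_intCast]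
  push_cast
  ring_nf

theorem norm_expMode (n : ℤ) (θ : ℝ) : ‖expMode n θ‖ = 1 := by
  have := Complex.norm_exp_ofReal_mul_I (n * θ)
  push_cast at this
  exact this

/-- Multiplication by the sine couples a mode to its two neighbours; this is the source of the
three-term recursion. -/
theorem sin_mul_expMode (n : ℤ) (θ : ℝ) : (Real.sin θ : ℂ) * expMode (-n) θ
    = (expMode (-(n - 1)) θ - expMode (-(n + 1)) θ) / (2 * Complex.I) := by
  have e1 : expMode (-(n - 1)) θ = Complex.exp (θ * Complex.I) * expMode (-n) θ := by
    rw [expMode, expMode, ← Complex.exp_add]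
    push_cast
    ring_nf
  have e2 : expMode (-(n + 1)) θ = Complex.exp (-θ * Complex.I) * expMode (-n) θ := by
    rw [expMode, expMode, ← Complex.exp_add]
    push_cast
    ring_nf
  rw [e1, e2, Complex.ofReal_sin, Complex.sin]
  field_simp
  rw [Complex.I_sq]
  ring

/-- The (unnormalized) Fourier coefficient `∫ e^{-inθ} h(θ) dθ`. -/
def coef (n : ℤ) : L2 →L[ℂ] ℂ :=
  innerSL ℂ ((memLp_of_continuous (contDiff_expMode n).continuous).toLp (expMode n))

theorem coef_apply (n : ℤ) (h : L2) : coef n h = ∫ θ, expMode (-n) θ * h θ ∂arc := by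
  rw [coef, innerSL_apply_apply, L2.inner_def]
  refine integral_congr_ae
    ((memLp_of_continuous (contDiff_expMode n).continuous).coeFn_toLp.mono fun θ hθ => ?_)
  simp only [hθ, RCLike.inner_apply, conj_expMode]
  rw [mul_comm]

/-- Carries Parseval's identity over to `coef`, for both square summability and uniqueness. -/
theorem coef_eq_fourierCoeffOn (n : ℤ) (h : L2) : coef n h
    = (2 * Real.pi : ℝ) • fourierCoeffOn (neg_lt_self Real.pi_pos) (fun θ => h θ) n := by
  have hpi : Real.pi ≠ 0 := Real.pi_ne_zero
  rw [fourierCoeffOn_eq_integral, coef_apply, integral_arc_eq_intervalIntegral, smul_smul]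
  have e : 2 * Real.pi * (1 / (Real.pi - -Real.pi)) = 1 := by
    field_simp
    ring
  rw [e, one_smul]
  refine intervalIntegral.integral_congr fun θ _ => ?_
  simp only [smul_eq_mul, fourier_coe_apply, expMode]
  congr 2
  have : (Real.pi : ℂ) ≠ 0 := by exact_mod_cast hpi
  push_cast
  rw [sub_neg_eq_add, ← two_mul]
  field_simp

theorem memLp_Ioc (h : L2) :
    MemLp (fun θ => h θ) 2 (volume.restrict (Ioc (-Real.pi) Real.pi)) := by
  rw [← restrict_Ioo_eq_restrict_Ioc]
  exact Lp.memLp h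

theorem summable_coef_sq (h : L2) : Summable fun n => ‖coef n h‖ ^ 2 := by
  refine ((hasSum_sq_fourierCoeffOn (neg_lt_self Real.pi_pos) (memLp_Ioc h)).summable.mul_left
    ((2 * Real.pi) ^ 2)).congr fun n => ?_
  rw [coef_eq_fourierCoeffOn, norm_smul, mul_pow (‖_‖), Real.norm_of_nonneg (by positivity)]

theorem eq_zero_of_coef_eq_zero {h : L2} (H : ∀ n, coef n h = 0) : h = 0 := by
  have hs := hasSum_sq_fourierCoeffOn (neg_lt_self Real.pi_pos) (memLp_Ioc h)
  have h0 : ∀ n, fourierCoeffOn (neg_lt_self Real.pi_pos) (fun θ => h θ) n = 0 := fun n => by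
    have := H n
    rw [coef_eq_fourierCoeffOn, smul_eq_zero] at this
    exact this.resolve_left (by positivity)
  simp only [h0, norm_zero, ne_eq, OfNat.ofNat_ne_zero, not_false_eq_true, zero_pow] at hs
  have hz := hs.unique hasSum_zero
  rw [smul_eq_zero, ← integral_arc_eq_intervalIntegral] at hz
  have hz' := hz.resolve_left (by
    have := Real.pi_pos
    rw [sub_neg_eq_add]
    positivity)
  rw [integral_eq_zero_iff_of_nonneg (fun _ => by positivity)
    ((memLp_two_iff_integrable_sq_norm (Lp.aestronglyMeasurable h)).1 (Lp.memLp h))] at hz'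
  apply Lp.ext
  filter_upwards [hz', Lp.coeFn_zero ℂ 2 arc] with θ h1 h2
  rw [h2]
  simpa using h1

theorem coef_weakDeriv {h g : L2} (H : IsWeakDeriv h g) (hp : IsPeriodic h) (n : ℤ) :
    coef n g = n * Complex.I * coef n h := by
  rw [coef_apply, coef_apply, H.integral_mul_of_isPeriodic hp (contDiff_expMode (-n))
    (expMode_period (-n)), ← integral_neg, ← integral_const_mul]
  refine integral_congr_ae (Eventually.of_forall fun θ => ?_)
  simp only [deriv_expMode]
  push_cast
  ring

theorem coef_weakDeriv_sinMul {g k : L2} (H : IsWeakDeriv (sinMul g) k) (n : ℤ) :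
    coef n k = n / 2 * (coef (n - 1) g - coef (n + 1) g) := by
  rw [coef_apply, H.integral_mul_of_sinMul (contDiff_expMode (-n)), coef_apply, coef_apply,
    ← integral_sub, ← integral_neg, ← integral_const_mul]
  · refine integral_congr_ae (Eventually.of_forall fun θ => ?_)
    have h := sin_mul_expMode n θ
    simp only [deriv_expMode]
    calc -(((-n : ℤ) : ℂ) * Complex.I * expMode (-n) θ * ((Real.sin θ : ℂ) * g θ))
        = n * Complex.I * ((Real.sin θ : ℂ) * expMode (-n) θ) * g θ := by
          push_cast
          ring
      _ = n / 2 * (expMode (-(n - 1)) θ * g θ - expMode (-(n + 1)) θ * g θ) := by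
          rw [h]
          field_simp
  · exact integrable_mul_of_continuous (contDiff_expMode _).continuous g
  · exact integrable_mul_of_continuous (contDiff_expMode _).continuous g

/-- The action of `L` on Fourier coefficients. -/
theorem coef_of_mem_LGraph {ε : ℝ} {x : L2 × L2} (hx : x ∈ LGraph ε) (n : ℤ) :
    coef n x.2 = Complex.I * (n * coef n x.1
      + ε / 2 * (n * (n - 1) * coef (n - 1) x.1 - n * (n + 1) * coef (n + 1) x.1)) := by
  obtain ⟨hp, g, k, h1, h2, h3⟩ := hx
  rw [h3, map_add, map_smul, coef_weakDeriv_sinMul h2, coef_weakDeriv h1 hp, coef_weakDeriv h1 hp,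
    coef_weakDeriv h1 hp, smul_eq_mul]
  push_cast
  ring

/-- For fixed n the relation involves finitely many continuous functionals, so it passes from
trigonometric polynomials to the closure of the graph without any description of the minimal domain.
-/
theorem coef_of_mem_LMin_graph {ε : ℝ} {x : L2 × L2} (hx : x ∈ (LMin ε).graph) (n : ℤ) :
    coef n x.2 = Complex.I * (n * coef n x.1
      + ε / 2 * (n * (n - 1) * coef (n - 1) x.1 - n * (n + 1) * coef (n + 1) x.1)) := by
  rw [LMin_graph] at hx
  have hcl : IsClosed {x : L2 × L2 | coef n x.2 = Complex.I * (n * coef n x.1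
      + ε / 2 * (n * (n - 1) * coef (n - 1) x.1 - n * (n + 1) * coef (n + 1) x.1))} :=
    isClosed_eq (by fun_prop) (by fun_prop)
  exact closure_minimal (fun y hy => coef_of_mem_LGraph (LFinGraph_le ε hy) n) hcl hx

/-! ### The spectral parameter of an eigenfunction -/

/-- The Fourier coefficients of an eigenfunction with eigenvalue `i μ`. -/
def IsModeSol (ε : ℝ) (μ : ℂ) (h : L2) : Prop :=
  ∀ n : ℤ, μ * coef n h = n * coef n h
      + ε / 2 * (n * (n - 1) * coef (n - 1) h - n * (n + 1) * coef (n + 1) h)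

theorem summable_sq_of_injective (h : L2) {i : ℕ → ℤ} (hi : Function.Injective i) :
    Summable fun n : ℕ => ‖if n = 0 then 0 else coef (i n) h‖ ^ 2 := by
  refine .of_nonneg_of_le (fun n => by positivity) (fun n => ?_)
    ((summable_coef_sq h).comp_injective hi)
  split_ifs
  · simp
  · exact le_rfl

theorem IsModeSol.re_pos {ε : ℝ} (hε0 : 0 < ε) (hε2 : ε < 2) {μ : ℂ} {h : L2}
    (H : IsModeSol ε μ h) (hne : ∃ n : ℕ, 0 < n ∧ coef n h ≠ 0) : μ.im = 0 ∧ 0 < μ.re := by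
  -- Overwriting the zeroth coefficient by 0 is harmless: it enters the equation for n = 1 only with
  -- the factor n(n-1) = 0.
  refine re_pos_of_recursion hε0 hε2 (v := fun n : ℕ => if n = 0 then 0 else coef n h)
    (summable_sq_of_injective h Nat.cast_injective) (by simp) (fun n => ?_) ?_
  · have := H (n + 1)
    rcases eq_or_ne n 0 with rfl | hn
    · simpa [add_assoc, one_add_one_eq_two] using this
    · simp only [hn, n.succ_ne_zero, (n + 1).succ_ne_zero, if_false]
      push_cast at this ⊢
      rw [add_sub_cancel_right, add_sub_cancel_right, add_assoc (n : ℤ),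
        add_assoc (n : ℂ) 1 1, one_add_one_eq_two, one_add_one_eq_two] at this
      exact this
  · obtain ⟨n, hn, h0⟩ := hne
    exact ⟨n, by simpa [hn.ne'] using h0⟩

/-- The reflection n ↦ -n turns the system of negative modes for μ into that of positive modes for
-μ. -/
theorem IsModeSol.re_neg {ε : ℝ} (hε0 : 0 < ε) (hε2 : ε < 2) {μ : ℂ} {h : L2}
    (H : IsModeSol ε μ h) (hne : ∃ n : ℕ, 0 < n ∧ coef (-n) h ≠ 0) : μ.im = 0 ∧ μ.re < 0 := by
  have key := re_pos_of_recursion hε0 hε2 (μ := -μ)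
    (v := fun n : ℕ => if n = 0 then 0 else coef (-n) h)
    (summable_sq_of_injective h (i := fun n : ℕ => -n) fun a b hab => by simpa using hab) (by simp)
    (fun n => ?_) ?_
  · simpa using key
  · have := H (-(n + 1))
    have e1 : (-((n : ℤ) + 1) + 1) = -n := by ring
    have e2 : (-((n : ℤ) + 1) - 1) = -(n + 2) := by ring
    rw [e1, e2] at this
    rcases eq_or_ne n 0 with rfl | hn
    · simp at this ⊢
      linear_combination -this
    · simp only [hn, n.succ_ne_zero, (n + 1).succ_ne_zero, if_false]
      push_cast at this ⊢
      linear_combination -this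
  · obtain ⟨n, hn, h0⟩ := hne
    exact ⟨n, by simpa [hn.ne'] using h0⟩

/-! ### Fourier coefficients of Hardy functions -/

/-- Vitali's theorem: on a finite measure space an L² bound implies uniform integrability, which
upgrades almost everywhere convergence to L¹ convergence. -/
theorem tendsto_integral_of_eLpNorm_two_le {α : Type*} [MeasurableSpace α] {ν : Measure α}
    [IsFiniteMeasure ν] {f : ℕ → α → ℂ} {g : α → ℂ} {D : ℝ}
    (hf : ∀ n, AEStronglyMeasurable (f n) ν) (hD : ∀ n, eLpNorm (f n) 2 ν ≤ ENNReal.ofReal D)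
    (hg : Integrable g ν) (hfg : ∀ᵐ x ∂ν, Tendsto (fun n => f n x) atTop (𝓝 (g x))) :
    Tendsto (fun n => ∫ x, f n x ∂ν) atTop (𝓝 (∫ x, g x ∂ν)) := by
  have hD' : ∀ n, eLpNorm (f n) 2 ν ≤ ENNReal.ofReal (|D| + 1) := fun n =>
    (hD n).trans (ENNReal.ofReal_le_ofReal (by linarith [le_abs_self D]))
  have hDpos : 0 < |D| + 1 := by positivity
  have hui : UnifIntegrable f 1 ν := by
    intro η hη
    -- By Hölder, the L¹ norm over s is at most the L² norm times ν(s)^(1/2); the square compensates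
    -- for that root, and |D| + 1 keeps the divisor positive.
    refine ⟨(η / (|D| + 1)) ^ 2, by positivity, fun n s hs hμ => ?_⟩
    rw [eLpNorm_indicator_eq_eLpNorm_restrict hs]
    refine (eLpNorm_le_eLpNorm_mul_rpow_measure_univ (q := 2) (by norm_num)
      (hf n).restrict).trans ?_
    rw [Measure.restrict_apply_univ]
    have h1 : ν s ^ (1 / (1 : ENNReal).toReal - 1 / (2 : ENNReal).toReal)
        ≤ ENNReal.ofReal (η / (|D| + 1)) := by
      refine (ENNReal.rpow_le_rpow hμ (by norm_num)).trans ?_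
      rw [ENNReal.ofReal_rpow_of_nonneg (by positivity) (by norm_num)]
      refine ENNReal.ofReal_le_ofReal (le_of_eq ?_)
      rw [← Real.rpow_natCast, ← Real.rpow_mul (by positivity)]
      norm_num
    refine (mul_le_mul' ((eLpNorm_restrict_le _ _ _ _).trans (hD' n)) h1).trans ?_
    rw [← ENNReal.ofReal_mul hDpos.le]
    refine ENNReal.ofReal_le_ofReal (le_of_eq ?_)
    field_simp
  have key := tendsto_Lp_finite_of_tendsto_ae le_rfl ENNReal.one_ne_top hf
    (memLp_one_iff_integrable.2 hg) hui hfg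
  refine tendsto_integral_of_L1' g hg.1 (Eventually.of_forall fun n => ?_) key
  exact MemLp.integrable (q := 2) (by norm_num) ⟨hf n, (hD n).trans_lt ENNReal.ofReal_lt_top⟩

/-- Cauchy's theorem for zᵏU on the circle of radius r: dz supplies one more factor of the
exponential, hence k + 1. Periodicity moves the interval from (0, 2π) to (-π, π). -/
theorem integral_expMode_mul_of_differentiableOn {U : ℂ → ℂ}
    (hU : DifferentiableOn ℂ U (Metric.ball 0 1)) {r : ℝ} (hr : r ∈ Ioo (0 : ℝ) 1) (k : ℕ) :
    ∫ θ : ℝ, expMode (k + 1 : ℕ) θ * U (r * Complex.exp (θ * Complex.I)) ∂arc = 0 := by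
  have hsub : Metric.closedBall (0 : ℂ) r ⊆ Metric.ball 0 1 := Metric.closedBall_subset_ball hr.2
  have hd : DifferentiableOn ℂ (fun z => z ^ k * U z) (Metric.closedBall 0 r) :=
    (differentiableOn_id.pow k).mul (hU.mono hsub)
  have hc : DiffContOnCl ℂ (fun z => z ^ k * U z) (Metric.ball 0 r) := by
    refine DifferentiableOn.diffContOnCl (hd.mono ?_)
    rw [closure_ball _ hr.1.ne']
  have h0 := hc.circleIntegral_eq_zero hr.1.le
  let F : ℝ → ℂ := fun θ => expMode (k + 1 : ℕ) θ * U (r * Complex.exp (θ * Complex.I))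
  have hper : Function.Periodic F (2 * Real.pi) := by
    intro θ
    have e1 : Complex.exp ((θ + 2 * Real.pi : ℝ) * Complex.I) = Complex.exp (θ * Complex.I) := by
      push_cast
      rw [add_mul]
      exact Complex.exp_periodic _
    have e2 : ∀ x : ℝ, expMode (k + 1 : ℕ) x = Complex.exp (x * Complex.I) ^ (k + 1) := by
      intro x
      rw [expMode, ← Complex.exp_nat_mul]
      push_cast
      ring_nf
    simp only [F, e2, e1]
  have e : (∮ z in C(0, r), z ^ k * U z)
      = (r : ℂ) ^ (k + 1) * Complex.I * ∫ θ in 0..2 * Real.pi, F θ := by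
    rw [circleIntegral, ← intervalIntegral.integral_const_mul]
    refine intervalIntegral.integral_congr fun θ _ => ?_
    simp only [F, deriv_circleMap, circleMap, zero_add, smul_eq_mul, expMode]
    have e3 : Complex.exp (((k + 1 : ℕ) : ℤ) * θ * Complex.I)
        = Complex.exp (θ * Complex.I) ^ (k + 1) := by
      rw [← Complex.exp_nat_mul]
      push_cast
      ring_nf
    rw [e3]
    ring
  rw [e] at h0
  have hr0 : (r : ℂ) ≠ 0 := by exact_mod_cast hr.1.ne'
  have h1 := (mul_eq_zero.1 h0).resolve_left (mul_ne_zero (pow_ne_zero _ hr0) Complex.I_ne_zero)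
  have h2 := hper.intervalIntegral_add_eq (-Real.pi) 0
  rw [zero_add, show -Real.pi + 2 * Real.pi = Real.pi by ring, h1] at h2
  rw [integral_arc_eq_intervalIntegral]
  exact h2

/-- The integrals vanish on every circle of radius r < 1; the Hardy bound and radial convergence let
r tend to 1 under the integral. -/
theorem coef_neg_of_mem_Hardy {h : L2} (hh : h ∈ Hardy) (k : ℕ) : coef (-(k + 1 : ℕ)) h = 0 := by
  obtain ⟨U, ⟨hU, C, hC⟩, hlim⟩ := hh
  obtain ⟨r, -, hr, hr1⟩ := exists_seq_strictMono_tendsto' (zero_lt_one' ℝ)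
  have hr1' : Tendsto r atTop (𝓝[<] 1) :=
    tendsto_nhdsWithin_iff.2 ⟨hr1, Eventually.of_forall fun n => (hr n).2⟩
  have hcont : ∀ n, Continuous fun θ : ℝ => U (r n * Complex.exp (θ * Complex.I)) := by
    intro n
    refine hU.continuousOn.comp_continuous (by fun_prop) fun θ => ?_
    simpa [Complex.norm_exp_ofReal_mul_I, abs_of_nonneg (hr n).1.le] using (hr n).2
  have hcont' : ∀ n, Continuous fun θ : ℝ =>
      expMode (k + 1 : ℕ) θ * U (r n * Complex.exp (θ * Complex.I)) :=
    fun n => (contDiff_expMode _).continuous.mul (hcont n)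
  have key := tendsto_integral_of_eLpNorm_two_le (ν := arc) (D := C ^ (2 : ℝ)⁻¹)
    (f := fun n θ => expMode (k + 1 : ℕ) θ * U (r n * Complex.exp (θ * Complex.I)))
    (g := fun θ => expMode (k + 1 : ℕ) θ * h θ)
    (fun n => (hcont' n).aestronglyMeasurable) (fun n => ?_)
    (integrable_mul_of_continuous (contDiff_expMode _).continuous h) ?_
  · simp only [fun n => integral_expMode_mul_of_differentiableOn hU (hr n) k] at key
    rw [coef_apply, neg_neg]
    exact tendsto_nhds_unique key tendsto_const_nhds
  · rw [(memLp_of_continuous (hcont' n)).eLpNorm_eq_integral_rpow_norm (by norm_num) (by norm_num)]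
    simp only [norm_mul, norm_expMode, one_mul, ENNReal.toReal_ofNat, Real.rpow_ofNat]
    refine ENNReal.ofReal_le_ofReal (Real.rpow_le_rpow ?_ (hC (r n) ⟨(hr n).1.le, (hr n).2⟩)
      (by norm_num))
    exact integral_nonneg fun θ => by positivity
  · filter_upwards [hlim] with θ hθ
    exact (hθ.comp hr1').const_mul _

theorem coef_zero_of_mem_Hardy0 {h : L2} (hh : h ∈ Hardy0) : coef 0 h = 0 := by
  have h1 := (Submodule.mem_orthogonal_singleton_iff_inner_right).1 hh.2
  rw [← h1, coef, innerSL_apply_apply]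
  congr 1
  apply Lp.ext
  filter_upwards [(memLp_of_continuous (contDiff_expMode 0).continuous).coeFn_toLp,
    Lp.coeFn_const 2 arc (1 : ℂ)] with θ a b
  rw [a, b]
  simp [expMode]

end ForwardBackwardHeat

end

/-! ### Eigenvalues of `APlus` and `L`. -/

theorem mainTheorem3 (ε : ℝ) (hε0 : 0 < ε) (hε2 : ε < 2) :
    (∀ z : ℂ, ForwardBackwardHeat.IsEigenvalue (ForwardBackwardHeat.APlus ε) z →
      z.im = 0 ∧ 0 < z.re) ∧
    (∀ z : ℂ, ForwardBackwardHeat.IsEigenvalue (ForwardBackwardHeat.L ε) z → z.re = 0) := by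
  open ForwardBackwardHeat in
  constructor
  · rintro z ⟨u, hu0, hu⟩
    obtain ⟨f, hf⟩ : ∃ f : Hardy0, f = LPlus ε u := ⟨_, rfl⟩
    have hg : ((u : Hardy0), f) ∈ (part (LMin ε) Hardy0).graph := by
      rw [hf]
      exact (LPlus ε).mem_graph u
    rw [part_graph] at hg
    have hzf : (-Complex.I) • (f : L2) = z • ((u : Hardy0) : L2) := by
      rw [hf]
      exact congrArg Subtype.val hu
    have hm : IsModeSol ε z ((u : Hardy0) : L2) := by
      intro n
      have h1 := coef_of_mem_LMin_graph hg n
      have h2 := congrArg (coef n) hzf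
      rw [map_smul, map_smul, smul_eq_mul, smul_eq_mul] at h2
      have h3 : coef n (f : L2) = _ := h1
      rw [← h2, h3, ← mul_assoc, neg_mul, Complex.I_mul_I, neg_neg, one_mul]
      rfl
    refine hm.re_pos hε0 hε2 ?_
    -- Membership in `Hardy0` kills all modes n ≤ 0, so without positive modes u would be zero.
    by_contra! hcon
    refine hu0 (Subtype.ext (eq_zero_of_coef_eq_zero fun n => ?_))
    rcases lt_trichotomy n 0 with h | rfl | h
    · obtain ⟨k, rfl⟩ := Int.exists_eq_neg_ofNat h.le
      obtain ⟨k, rfl⟩ := Nat.exists_eq_succ_of_ne_zero (n := k) (by rintro rfl; simp at h)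
      exact coef_neg_of_mem_Hardy (u : Hardy0).2.1 k
    · exact coef_zero_of_mem_Hardy0 (u : Hardy0).2
    · lift n to ℕ using h.le
      exact hcon n (by exact_mod_cast h)
  · rintro z ⟨u, hu0, hu⟩
    have hg : ((u : L2), z • (u : L2)) ∈ LGraph ε := by
      rw [← L_graph, ← hu]
      exact (L ε).mem_graph u
    -- Writing z = iμ gives μ = -iz, and Im μ = 0 says Re z = 0.
    have hm : IsModeSol ε (-Complex.I * z) (u : L2) := by
      intro n
      have h1 : coef n (z • (u : L2)) = _ := coef_of_mem_LGraph hg n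
      rw [map_smul, smul_eq_mul] at h1
      rw [mul_assoc, h1, ← mul_assoc, neg_mul, Complex.I_mul_I, neg_neg, one_mul]
    have him : (-Complex.I * z).im = 0 → z.re = 0 := by simp
    by_cases hpos : ∃ n : ℕ, 0 < n ∧ coef n (u : L2) ≠ 0
    · exact him (hm.re_pos hε0 hε2 hpos).1
    by_cases hneg : ∃ n : ℕ, 0 < n ∧ coef (-n) (u : L2) ≠ 0
    · exact him (hm.re_neg hε0 hε2 hneg).1
    push Not at hpos hneg
    have h0 : coef 0 (u : L2) ≠ 0 := by
      intro h0
      refine hu0 (eq_zero_of_coef_eq_zero fun n => ?_)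
      rcases lt_trichotomy n 0 with h | rfl | h
      · obtain ⟨k, rfl⟩ := Int.exists_eq_neg_ofNat h.le
        exact hneg k (by simpa using h)
      · exact h0
      · lift n to ℕ using h.le
        exact hpos n (by exact_mod_cast h)
    -- Only the constant mode survives; the equation for n = 0 reads μ v₀ = 0, so z = 0.
    have := hm 0
    simp [h0] at this
    simp [this]
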